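/- Let $K$ be any field, $n\ge 0$ and $s\ge 1$ integers, and $X_1,\dots,X_s$ effective algebraic cycles on $\mathbb A^n=\mathbb A^n_K$, i.e. finite formal sums $\sum_j a_{j}[X_{j}]$, $a_j\in\mathbb Z_{\ge 0}$, of reduced and irreducible closed subschemes, possibly of different dimensions. For a closed subscheme $V$ of an affine space let $[V]$ denote its cycle: the sum of its irreducible components, each with multiplicity the length of the local ring of $V$ at its generic point. For a subvariety $W$ (reduced and irreducible) and a hyperplane $L$ put $[W]\pitchfork L:=[W]$ if $W\subset L$ and $[W]\pitchfork L:=[W\cap L]$ (scheme-theoretic intersection) otherwise, and extend this linearly to cycles. The product cycle $X_1\times\cdots\times X_s$ on $\mathbb A^{ns}=\mathbb A^n\times\cdots\times\mathbb A^n$ is the multilinear extension of $(W_1,\dots,W_s)\mapsto[W_1\times\cdots\times W_s]$. Let $L_1,\dots,L_{n(s-1)}$ be any ordered set of hyperplanes in $\mathbb A^{ns}$ whose intersection is the diagonal $\Delta\cong\mathbb A^n$. Every component of $$\bigl(\cdots\bigl((X_1\times\cdots\times X_s)\pitchfork L_1\bigr)\pitchfork\cdots\bigr)\pitchfork L_{n(s-1)}$$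 lies in $\Delta$, and the cycle on $\mathbb A^n$ corresponding to it under a coordinate projection $\Delta\cong\mathbb A^n$ is called an intersection cycle of $X_1,\dots,X_s$ and denoted $X_1\pitchfork\cdots\pitchfork X_s$ (it depends on the choice of the $L_k$). The degree of a cycle $\sum_j a_j[Z_j]$ on $\mathbb A^n$ is $\sum_j a_j\deg \overline{Z_j}$, where $\overline{Z_j}$ is the closure of $Z_j$ in $\mathbb P^n$ and $\deg\overline{Z_j}$ is its degree with respect to $\mathcal O_{\mathbb P^n}(1)$ (that is, $d!$ times the leading coefficient of its Hilbert polynomial, $d=\dim Z_j$). Then every intersection cycle $X_1\pitchfork\cdots\pitchfork X_s$ satisfies $$\deg (X_1\pitchfork\cdots\pitchfork X_s)\le \prod_{j=1}^s\deg X_j .$$ -/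

import Mathlib

noncomputable section

namespace VogelCycle

/-! ### Algebraic cycles on affine schemes -/

/-- The group of algebraic cycles `Z_*(Spec R)`: the free abelian group on the reduced and
irreducible closed subschemes of `Spec R`, each given by its prime ideal (its generic point).
The subschemes in one cycle may have different dimensions. A cycle `Z` is effective
if `0 ≤ Z`, that is, if all its coefficients are nonnegative. -/
abbrev Cycle (R : Type*) [CommRing R] : Type _ := PrimeSpectrum R →₀ ℤ

/-- The multiplicity of the closed subscheme `V(I)` along `V(q)`: the length of the local ring
`(R / I)_q = R_q / I R_q` of `V(I)` at `q` (as a module over `R_q`). It is finite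
if `R` is Noetherian and `q` is a minimal prime over `I`. -/
def multAlong {R : Type*} [CommRing R] (I : Ideal R) (q : PrimeSpectrum R) : ℕ :=
  (Module.length (Localization.AtPrime q.asIdeal)
    (Localization.AtPrime q.asIdeal ⧸
      I.map (algebraMap R (Localization.AtPrime q.asIdeal)))).toNat

/-- The cycle `[V(I)]` of the closed subscheme `V(I) ⊆ Spec R`: the sum of its irreducible
components (the minimal primes over `I`), each with its multiplicity. -/
def schemeCycle {R : Type*} [CommRing R] [IsNoetherianRing R] (I : Ideal R) : Cycle R :=
  Finsupp.onFinset
    ((I.finite_minimalPrimes_of_isNoetherianRing R).preimage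
      (f := PrimeSpectrum.asIdeal) (fun _ _ _ _ h => PrimeSpectrum.ext h)).toFinset
    ({q | q.asIdeal ∈ I.minimalPrimes}.indicator fun q => (multAlong I q : ℤ))
    (by
      intro q hq
      simp only [Set.Finite.mem_toFinset, Set.mem_preimage]
      by_contra h
      exact hq (Set.indicator_of_notMem (s := {q : PrimeSpectrum R | q.asIdeal ∈ I.minimalPrimes}) h _))

open Classical in
/-- The intersection of `V(p)` with the divisor `D = (f = 0)`: it is `V(p)` itself if
`V(p) ⊆ D`, and otherwise the cycle of the Cartier divisor `D|_{V(p)}`, which is the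
closed subscheme `V(p + (f))`. -/
def cutPrime {R : Type*} [CommRing R] [IsNoetherianRing R]
    (p : PrimeSpectrum R) (f : R) : Cycle R :=
  if f ∈ p.asIdeal then Finsupp.single p 1 else schemeCycle (p.asIdeal ⊔ Ideal.span {f})

/-- The intersection of a cycle with the divisor `(f = 0)`, extended linearly from `cutPrime`. -/
def cut {R : Type*} [CommRing R] [IsNoetherianRing R] (Z : Cycle R) (f : R) : Cycle R :=
  Z.sum fun p a => a • cutPrime p f

/-- Successive intersection with `(f = 0)` for the members `f` of a list, first one first. -/
def cutList {R : Type*} [CommRing R] [IsNoetherianRing R] (Z : Cycle R) (L : List R) : Cycle R :=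
  L.foldl cut Z

/-! ### Products and intersection cycles in affine space

`𝔸ⁿ` is `Spec K[x_j : j ∈ Fin n]`, and `𝔸ⁿˢ = 𝔸ⁿ × ⋯ × 𝔸ⁿ` is
`Spec K[x_{ij} : (i, j) ∈ Fin s × Fin n]`. -/

variable {K : Type*} [Field K]

/-- The pullback of functions `K[𝔸ⁿ] → K[𝔸ⁿˢ]` along the projection onto the factor `r`. -/
def projPullback (K : Type*) [Field K] {s : ℕ} (n : ℕ) (r : Fin s) :
    MvPolynomial (Fin n) K →ₐ[K] MvPolynomial (Fin s × Fin n) K :=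
  MvPolynomial.rename fun j => (r, j)

/-- The pullback of functions `K[𝔸ⁿˢ] → K[𝔸ⁿ]`, `x_{ij} ↦ x_j`, along the diagonal map. -/
def diagPullback (K : Type*) [Field K] (n s : ℕ) :
    MvPolynomial (Fin s × Fin n) K →ₐ[K] MvPolynomial (Fin n) K :=
  MvPolynomial.rename Prod.snd

/-- The diagonal `Δ ⊆ 𝔸ⁿ × ⋯ × 𝔸ⁿ`, the image of the diagonal map of schemes. -/
def diagonal (K : Type*) [Field K] (n s : ℕ) :
    Set (PrimeSpectrum (MvPolynomial (Fin s × Fin n) K)) :=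
  Set.range (PrimeSpectrum.comap (diagPullback K n s).toRingHom)

/-- The cycle of the product scheme `V(p₁) × ⋯ × V(pₛ) ⊆ 𝔸ⁿˢ`. If `K` is algebraically
closed, this is a single subvariety with multiplicity one. -/
def prodPrimes {n s : ℕ} (p : Fin s → PrimeSpectrum (MvPolynomial (Fin n) K)) :
    Cycle (MvPolynomial (Fin s × Fin n) K) :=
  schemeCycle (⨆ i, (p i).asIdeal.map (projPullback K n i).toRingHom)

/-- The product cycle `X₁ × ⋯ × Xₛ` on `𝔸ⁿˢ`, extended multilinearly from `prodPrimes`. -/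
def prodCycle {n s : ℕ} (X : Fin s → Cycle (MvPolynomial (Fin n) K)) :
    Cycle (MvPolynomial (Fin s × Fin n) K) :=
  ∑ p ∈ Fintype.piFinset fun i => (X i).support, (∏ i, X i (p i)) • prodPrimes p

/-- An ordered set of `n (s - 1)` hyperplanes `(ℓ_k = 0)` of `𝔸ⁿˢ` whose intersection
is the diagonal. -/
structure IsDiagonalSystem {n s : ℕ}
    (ℓ : Fin (n * (s - 1)) → MvPolynomial (Fin s × Fin n) K) : Prop where
  hyperplane : ∀ k, (ℓ k).totalDegree = 1
  iInter_eq : ⋂ k, PrimeSpectrum.zeroLocus {ℓ k} = diagonal K n s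

/-- `Z` is an intersection cycle of `X₁, …, Xₛ`: the product cycle is cut successively with the
hyperplanes of a system `ℓ` that cuts out the diagonal, and the result, whose components all lie
in the diagonal, is carried to `𝔸ⁿ` by one of the projections (which is an isomorphism from
the diagonal to `𝔸ⁿ`). -/
def IsIntersectionCycle {n s : ℕ} (X : Fin s → Cycle (MvPolynomial (Fin n) K))
    (Z : Cycle (MvPolynomial (Fin n) K)) : Prop :=
  ∃ (ℓ : Fin (n * (s - 1)) → MvPolynomial (Fin s × Fin n) K) (r : Fin s),
    IsDiagonalSystem ℓ ∧
    Z = Finsupp.mapDomain (PrimeSpectrum.comap (projPullback K n r).toRingHom)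
      (cutList (prodCycle X) (List.ofFn ℓ))

/-! ### Degrees

`ℙⁿ` has the homogeneous coordinate ring `K[x₀, x_j : j ∈ σ]`, with `x₀` the variable
`none : Option σ`, and `𝔸ⁿ ⊆ ℙⁿ` is the open set `x₀ ≠ 0`. -/

/-- Dehomogenization `F ↦ F(1, x)`, the restriction of forms from `ℙⁿ` to `𝔸ⁿ`. -/
def dehomogenize (K : Type*) [Field K] (σ : Type*) :
    MvPolynomial (Option σ) K →ₐ[K] MvPolynomial σ K :=
  MvPolynomial.aeval fun o => o.elim 1 MvPolynomial.X

/-- The homogeneous ideal of the closure in `ℙⁿ` of the subvariety `V(p) ⊆ 𝔸ⁿ`: it is generated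
by the forms that vanish on `V(p)`. -/
def closureIdeal {σ : Type*} (p : PrimeSpectrum (MvPolynomial σ K)) :
    Ideal (MvPolynomial (Option σ) K) :=
  Ideal.span {F | (∃ t : ℕ, F.IsHomogeneous t) ∧ dehomogenize K σ F ∈ p.asIdeal}

/-- The Hilbert function of a homogeneous ideal `I`: the dimension of the part of
degree `t` of the graded ring `K[x] / I`. -/
def hilbertFunction {τ : Type*} (I : Ideal (MvPolynomial τ K)) (t : ℕ) : ℕ :=
  Module.finrank K
    ((MvPolynomial.homogeneousSubmodule τ K t).map (Ideal.Quotient.mkₐ K I).toLinearMap)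

open Classical in
/-- The Hilbert polynomial of a homogeneous ideal `I`: the polynomial (unique, and existing for
every homogeneous ideal in finitely many variables) that agrees with the Hilbert function
at all large integers. -/
def hilbertPolynomial {τ : Type*} (I : Ideal (MvPolynomial τ K)) : Polynomial ℚ :=
  if h : ∃ P : Polynomial ℚ, ∀ᶠ t : ℕ in Filter.atTop, P.eval (t : ℚ) = hilbertFunction I t
  then h.choose else 0

/-- The degree of the projective scheme defined by a homogeneous ideal, with respect to `𝒪(1)`:
`d!` times the leading coefficient of the Hilbert polynomial, `d` being the degree of that
polynomial (which is the dimension of the scheme). -/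
def projDegree {τ : Type*} (I : Ideal (MvPolynomial τ K)) : ℚ :=
  ((hilbertPolynomial I).natDegree.factorial : ℚ) * (hilbertPolynomial I).leadingCoeff

/-- The degree of a cycle on affine space, extended linearly from the degrees of the closures
in projective space of its components. -/
def degree {σ : Type*} (Z : Cycle (MvPolynomial σ K)) : ℚ :=
  Z.sum fun p a => (a : ℚ) * projDegree (closureIdeal p)

end VogelCycle

end

/-! The degree of a variety $V(p)$ of dimension $d$ is $d!$ times the coefficient of $t^d$ in its
affine Hilbert function $H_p(t)$, the dimension of the image in $K[x]/p$ of the polynomials of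
degree at most $t$ (`hilbertFunction_closureIdeal`). So everything reduces to inequalities between
affine Hilbert functions, and the degree is followed through three operations: forming the product
cycle (at most the product of the degrees), cutting with a hyperplane (the degree does not grow),
and projecting the diagonal to $\mathbb A^n$ (the degree is unchanged).

The first two operations produce the cycle of a scheme $V(J)$ and rest on `degree_schemeCycle_le`:
if $H_J$ is bounded by a polynomial $U$ of degree at most $e$ and all components of $V(J)$ have
dimension at least $e$, then the degree of $[V(J)]$ is at most $e!$ times the coefficient of $t^e$
in $U$. The reason is a prime filtration of $K[x]/J$ (`exists_sum_mul_affineRank_le`): each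
component $q$ occurs in it at least as often as its multiplicity, and each occurrence contributes a
shifted copy of $H_q$; shifts do not affect top coefficients.

For a cut with $f\notin p$, multiplication by $f$ is injective on $K[x]/p$, so $H_{p+(f)}(t)\le
H_p(t)-H_p(t-1)$, which gives $U$. The dimension bound is Krull's principal ideal theorem, carried
to a Noether normalization by going down (`le_natDegree_of_mem_minimalPrimes`). For a product, $H$
is bounded by the partial sums of the convolution of the first differences of the $H_{p_i}$. Over an
arbitrary field the product scheme need not be integral, but its coordinate ring embeds into a free
module over a polynomial ring in $\sum d_i$ variables, so that ring meets no minimal prime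
(`le_natDegree_of_mem_minimalPrimes_prodIdeal`).

Generating functions keep track of leading coefficients: $\sum_t H_p(t)X^t=N/(1-X)^{d+1}$ with
$N(1)=\deg$. Cutting keeps $N$ and lowers the exponent; products multiply the $N$. -/

noncomputable section
namespace VogelCycle

open Polynomial Filter

/-! ### Sequences that agree with a polynomial at large integers -/

/-- A sequence that eventually agrees with a polynomial of degree less than `d` has a generating
function of the form `N / (1 - X) ^ d`. -/
theorem exists_polynomial_eq_one_sub_pow_mul (d : ℕ) (f : ℕ → ℚ) (P : ℚ[X])
    (hP : P.degree < d) (h : ∀ᶠ t : ℕ in atTop, P.eval (t : ℚ) = f t) :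
    ∃ N : ℚ[X], (N : PowerSeries ℚ) = (1 - PowerSeries.X) ^ d * PowerSeries.mk f := by
  induction d generalizing f P with
  | zero =>
    have hP0 : P = 0 := by
      rw [← degree_eq_bot]
      by_contra hne
      have : P ≠ 0 := fun h0 => hne (by simp [h0])
      rw [degree_eq_natDegree this] at hP
      exact absurd (Nat.cast_lt.mp hP) (Nat.not_lt_zero _)
    subst hP0
    obtain ⟨T, hT⟩ := eventually_atTop.mp h
    refine ⟨(PowerSeries.mk f).trunc T, ?_⟩
    ext k
    rw [pow_zero, one_mul, Polynomial.coeff_coe, PowerSeries.coeff_trunc]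
    split_ifs with hk
    · rfl
    · rw [PowerSeries.coeff_mk, ← hT k (not_lt.mp hk), eval_zero]
  | succ d ih =>
    -- Multiplication by $1-X$ takes first differences, so the induction passes to `P - taylor (-1)
    -- P`, that is $P(X)-P(X-1)$, in which the leading terms cancel.
    let g : ℕ → ℚ := fun t => PowerSeries.coeff t ((1 - PowerSeries.X) * PowerSeries.mk f)
    have hg : PowerSeries.mk g = (1 - PowerSeries.X) * PowerSeries.mk f := by
      ext k; simp [g]
    have hdeg : (P - taylor (-1) P).degree < d := by
      by_cases h0 : P = 0
      · subst h0; simp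
      · have h1 : (P - taylor (-1) P).degree < P.degree :=
          degree_sub_lt_left (degree_taylor _ _).symm h0 (leadingCoeff_taylor _ _).symm
        rw [degree_eq_natDegree h0] at hP h1
        have h2 : P.natDegree ≤ d := Nat.lt_succ_iff.mp (Nat.cast_lt.mp hP)
        exact lt_of_lt_of_le h1 (Nat.cast_le.mpr h2)
    obtain ⟨N, hN⟩ := ih g (P - taylor (-1) P) hdeg (by
      obtain ⟨T, hT⟩ := eventually_atTop.mp h
      refine eventually_atTop.mpr ⟨T + 1, fun t ht => ?_⟩
      obtain ⟨u, rfl⟩ : ∃ u, t = u + 1 := ⟨t - 1, by omega⟩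
      have h1 := hT (u + 1) (by omega)
      have h2 := hT u (by omega)
      have hc : ((u + 1 : ℕ) : ℚ) + -1 = (u : ℚ) := by push_cast; ring
      have hgu : g (u + 1) = f (u + 1) - f u := by
        simp only [g, sub_mul, one_mul, map_sub, PowerSeries.coeff_succ_X_mul,
          PowerSeries.coeff_mk]
      rw [eval_sub, taylor_eval, hc, h1, h2, hgu])
    exact ⟨N, by rw [hN, hg, pow_succ, mul_assoc]⟩

/-- Converse passage, from a rational generating function back to a polynomial; beyond the degree of
the numerator the coefficients of $N/(1-X)^d$ are polynomial in the index. -/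
theorem eventually_eval_hilbertPoly {N : ℚ[X]} {d : ℕ} {f : ℕ → ℚ}
    (h : (N : PowerSeries ℚ) = (1 - PowerSeries.X) ^ d * PowerSeries.mk f) :
    ∀ᶠ t : ℕ in atTop, (hilbertPoly N d).eval (t : ℚ) = f t := by
  refine eventually_atTop.mpr ⟨N.natDegree + 1, fun t ht => ?_⟩
  rw [← coeff_mul_invOneSubPow_eq_hilbertPoly_eval d (by omega : N.natDegree < t), h, mul_comm,
    ← mul_assoc, ← PowerSeries.invOneSubPow_inv_eq_one_sub_pow]
  simp

/-- Each summand of the Hilbert polynomial has top coefficient $1/d!$, so only the sum of the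
coefficients of $N$ survives. This makes $N(1)$ the carrier of the degree. -/
theorem coeff_hilbertPoly_succ (N : ℚ[X]) (d : ℕ) :
    (d.factorial : ℚ) * (hilbertPoly N (d + 1)).coeff d = N.eval 1 := by
  rw [hilbertPoly_succ, finsetSum_coeff, Finset.mul_sum, eval_eq_sum, Polynomial.sum]
  refine Finset.sum_congr rfl fun i _ => ?_
  have : (d.factorial : ℚ) ≠ 0 := by positivity
  rw [coeff_smul, coeff_preHilbertPoly_self]
  simp only [smul_eq_mul, one_pow, mul_one]
  field_simp

theorem natDegree_hilbertPoly_succ_le (N : ℚ[X]) (d : ℕ) :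
    (hilbertPoly N (d + 1)).natDegree ≤ d := by
  rw [hilbertPoly_succ]
  refine natDegree_sum_le_of_forall_le _ _ fun i _ => (natDegree_smul_le _ _).trans ?_
  rw [natDegree_preHilbertPoly]

theorem eq_of_eventually_eval_eq {P Q : ℚ[X]}
    (h : ∀ᶠ t : ℕ in atTop, P.eval (t : ℚ) = Q.eval (t : ℚ)) : P = Q := by
  obtain ⟨T, hT⟩ := eventually_atTop.mp h
  refine eq_of_infinite_eval_eq P Q (Set.infinite_of_injective_forall_mem
    (f := fun k : ℕ => ((k + T : ℕ) : ℚ)) (fun a b hab => ?_) fun k => hT _ (by omega))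
  have := Nat.cast_injective (R := ℚ) hab
  omega

theorem leadingCoeff_nonneg_of_eventually {P : ℚ[X]}
    (h : ∀ᶠ t : ℕ in atTop, 0 ≤ P.eval (t : ℚ)) : 0 ≤ P.leadingCoeff := by
  by_contra! hlt
  have hneg : ∀ᶠ t : ℕ in atTop, P.eval (t : ℚ) < 0 := by
    by_cases h0 : 0 < P.degree
    · exact (tendsto_natCast_atTop_atTop (R := ℚ)).eventually
        ((P.tendsto_atBot_of_leadingCoeff_nonpos h0 hlt.le).eventually (eventually_lt_atBot 0))
    · have := eq_C_of_degree_le_zero (not_lt.mp h0)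
      rw [this] at hlt ⊢
      exact Eventually.of_forall fun t => by simpa using hlt
  obtain ⟨t, h1, h2⟩ := (h.and hneg).exists
  exact absurd h1 (not_le.mpr h2)

/-- The difference $Q-P$ has a nonnegative leading coefficient; it either sits in degree $e$, or the
two coefficients agree. Either polynomial may have degree below $e$. -/
theorem coeff_le_coeff_of_eventually {P Q : ℚ[X]} {e : ℕ} (hP : P.natDegree ≤ e)
    (hQ : Q.natDegree ≤ e)
    (h : ∀ᶠ t : ℕ in atTop, P.eval (t : ℚ) ≤ Q.eval (t : ℚ)) : P.coeff e ≤ Q.coeff e := by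
  have h1 : 0 ≤ (Q - P).leadingCoeff := leadingCoeff_nonneg_of_eventually
    (h.mono fun t ht => by rw [eval_sub]; linarith)
  have hd : (Q - P).natDegree ≤ e := (natDegree_sub_le_of_le hQ hP).trans (max_self e).le
  rcases hd.lt_or_eq with hlt | heq
  · have := coeff_eq_zero_of_natDegree_lt hlt
    rw [coeff_sub] at this; linarith
  · rw [leadingCoeff, heq, coeff_sub] at h1; linarith

theorem natDegree_le_of_eventually_le {P Q : ℚ[X]}
    (h0 : ∀ᶠ t : ℕ in atTop, 0 ≤ P.eval (t : ℚ))
    (h : ∀ᶠ t : ℕ in atTop, P.eval (t : ℚ) ≤ Q.eval (t : ℚ)) : P.natDegree ≤ Q.natDegree := by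
  by_contra! hlt
  have h1 := leadingCoeff_nonneg_of_eventually h0
  have h2 := coeff_le_coeff_of_eventually le_rfl hlt.le h
  rw [coeff_eq_zero_of_natDegree_lt hlt] at h2
  have h3 : P.leadingCoeff = 0 := le_antisymm h2 h1
  rw [leadingCoeff_eq_zero] at h3
  simp [h3] at hlt

end VogelCycle
end

noncomputable section
namespace VogelCycle

open Polynomial Filter

/-! ### Hilbert functions of homogeneous ideals -/

theorem finrank_map_add_finrank_inf_ker {K V W : Type*} [Field K] [AddCommGroup V] [Module K V]
    [AddCommGroup W] [Module K W] (U : Submodule K V) [FiniteDimensional K U] (f : V →ₗ[K] W) :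
    Module.finrank K (U.map f) + Module.finrank K ↥(U ⊓ LinearMap.ker f) =
      Module.finrank K U := by
  have h := LinearMap.finrank_range_add_finrank_ker (f.domRestrict U)
  rw [LinearMap.range_domRestrict] at h
  have h2 : (LinearMap.ker (f.domRestrict U)).map U.subtype = U ⊓ LinearMap.ker f := by
    ext x
    simp only [Submodule.mem_map, LinearMap.mem_ker, LinearMap.domRestrict_apply,
      Submodule.subtype_apply, Subtype.exists, Submodule.mem_inf]
    constructor
    · rintro ⟨a, ha, h, rfl⟩; exact ⟨ha, h⟩
    · rintro ⟨ha, h⟩; exact ⟨x, ha, h, rfl⟩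
  rw [← h2, Submodule.finrank_map_subtype_eq]
  exact h

variable {K : Type*} [Field K]

/-- The sequences whose generating function is a rational function with denominator a power
of `1 - X`; equivalently, those that eventually agree with a polynomial. -/
def IsHilbertSequence (f : ℕ → ℚ) : Prop :=
  ∃ (N : ℚ[X]) (d : ℕ), (N : PowerSeries ℚ) = (1 - PowerSeries.X) ^ d * PowerSeries.mk f

theorem IsHilbertSequence.of_sub {f a b : ℕ → ℚ} (ha : IsHilbertSequence a)
    (hb : IsHilbertSequence b) (h : ∀ t, f (t + 1) - f t = a (t + 1) - b t) :
    IsHilbertSequence f := by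
  obtain ⟨N, d, hN⟩ := ha
  obtain ⟨M, e, hM⟩ := hb
  -- The hypothesis says nothing about the term at $0$; the constant `f 0 - a 0` corrects it.
  have key : (1 - PowerSeries.X) * PowerSeries.mk f =
      PowerSeries.mk a - PowerSeries.X * PowerSeries.mk b + PowerSeries.C (f 0 - a 0) := by
    ext k
    cases k with
    | zero => simp [sub_mul]
    | succ k =>
      rw [sub_mul, one_mul, map_sub, map_add, map_sub, PowerSeries.coeff_succ_X_mul,
        PowerSeries.coeff_succ_X_mul, PowerSeries.coeff_mk, PowerSeries.coeff_mk,
        PowerSeries.coeff_mk, PowerSeries.coeff_mk, PowerSeries.coeff_C, if_neg (by omega), h]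
      ring
  refine ⟨(1 - X) ^ e * N - (1 - X) ^ d * X * M + (1 - X) ^ (d + e) * Polynomial.C (f 0 - a 0),
    d + e + 1, ?_⟩
  rw [pow_succ, mul_assoc _ (1 - PowerSeries.X) (PowerSeries.mk f), key]
  push_cast
  rw [hN, hM]
  ring

theorem IsHilbertSequence.of_eventually_eq {f : ℕ → ℚ} (P : ℚ[X])
    (h : ∀ᶠ t : ℕ in atTop, P.eval (t : ℚ) = f t) : IsHilbertSequence f := by
  obtain ⟨N, hN⟩ := exists_polynomial_eq_one_sub_pow_mul (P.natDegree + 1) f P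
    (lt_of_le_of_lt degree_le_natDegree (by exact_mod_cast Nat.lt_succ_self _)) h
  exact ⟨N, _, hN⟩

theorem IsHilbertSequence.exists_polynomial {f : ℕ → ℚ} (h : IsHilbertSequence f) :
    ∃ P : ℚ[X], ∀ᶠ t : ℕ in atTop, P.eval (t : ℚ) = f t := by
  obtain ⟨N, d, hN⟩ := h
  exact ⟨_, eventually_eval_hilbertPoly hN⟩

section Homogeneous

open MvPolynomial

variable {τ : Type*}

theorem homogeneousComponent_succ_X_mul (i : τ) (f : MvPolynomial τ K) (t : ℕ) :
    homogeneousComponent (t + 1) (MvPolynomial.X i * f) =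
      MvPolynomial.X i * homogeneousComponent t f := by
  induction f using MvPolynomial.induction_on' with
  | monomial a r =>
    have h1 : (MvPolynomial.X i * monomial a r).IsHomogeneous (1 + a.degree) :=
      (isHomogeneous_X K i).mul (isHomogeneous_monomial r rfl)
    rw [homogeneousComponent_of_mem h1,
      homogeneousComponent_of_mem (isHomogeneous_monomial r rfl)]
    by_cases h : t = a.degree
    · rw [if_pos h, if_pos (by omega)]
    · rw [if_neg h, if_neg (by omega), mul_zero]
  | add p q hp hq => rw [mul_add, map_add, hp, hq, map_add, mul_add]

theorem homogeneousComponent_zero_X_mul (i : τ) (f : MvPolynomial τ K) :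
    homogeneousComponent 0 (MvPolynomial.X i * f) = 0 := by
  rw [homogeneousComponent_zero, ← constantCoeff_eq, map_mul, constantCoeff_X, zero_mul, map_zero]

/-- The dimension of the part of degree `t` of an ideal. -/
def gradedRank (I : Ideal (MvPolynomial τ K)) (t : ℕ) : ℕ :=
  Module.finrank K ↥(I.restrictScalars K ⊓ homogeneousSubmodule τ K t)

instance finite_homogeneousSubmodule [Finite τ] (t : ℕ) :
    FiniteDimensional K (homogeneousSubmodule τ K t) :=
  Module.Finite.iff_fg.mpr (homogeneousSubmodule_fg τ K t)

theorem hilbertFunction_add_gradedRank [Finite τ] (I : Ideal (MvPolynomial τ K)) (t : ℕ) :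
    hilbertFunction I t + gradedRank I t = Module.finrank K (homogeneousSubmodule τ K t) := by
  rw [← finrank_map_add_finrank_inf_ker (homogeneousSubmodule τ K t)
    (Ideal.Quotient.mkₐ K I).toLinearMap, hilbertFunction, gradedRank, inf_comm]
  have : I.restrictScalars K = LinearMap.ker (Ideal.Quotient.mkₐ K I).toLinearMap := by
    ext x
    simp [Ideal.Quotient.eq_zero_iff_mem]
  rw [this]

/-- The ideal `J + x I`. -/
def supXMul (J I : Ideal (MvPolynomial τ K)) (x : τ) : Ideal (MvPolynomial τ K) :=
  J ⊔ Submodule.map (LinearMap.mulLeft (MvPolynomial τ K) (MvPolynomial.X x)) I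

/-- The ideal of all `f ∈ I` with `x f ∈ J`. -/
def infXColon (J I : Ideal (MvPolynomial τ K)) (x : τ) : Ideal (MvPolynomial τ K) :=
  I ⊓ Submodule.comap (LinearMap.mulLeft (MvPolynomial τ K) (MvPolynomial.X x)) J

theorem mem_supXMul {J I : Ideal (MvPolynomial τ K)} {x : τ} {f : MvPolynomial τ K} :
    f ∈ supXMul J I x ↔ ∃ j ∈ J, ∃ g ∈ I, j + MvPolynomial.X x * g = f := by
  simp [supXMul, Submodule.mem_sup]

theorem mem_infXColon {J I : Ideal (MvPolynomial τ K)} {x : τ} {f : MvPolynomial τ K} :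
    f ∈ infXColon J I x ↔ f ∈ I ∧ MvPolynomial.X x * f ∈ J := by
  simp [infXColon]

/-- In degree $t+1$, $J+xI$ is the sum of $J_{t+1}$ and $xI_t$, and these meet in $x$ times the
elements of $I_t$ that $x$ carries into $J$. Since multiplication by $x$ is injective, the dimension
formula for a sum of two subspaces applies. -/
theorem gradedRank_supXMul [Finite τ] {J I : Ideal (MvPolynomial τ K)} (x : τ)
    (hJ : ∀ f ∈ J, ∀ t, homogeneousComponent t f ∈ J)
    (hI : ∀ f ∈ I, ∀ t, homogeneousComponent t f ∈ I) (t : ℕ) :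
    gradedRank (supXMul J I x) (t + 1) + gradedRank (infXColon J I x) t =
      gradedRank J (t + 1) + gradedRank I t := by
  let m : MvPolynomial τ K →ₗ[K] MvPolynomial τ K := LinearMap.mulLeft K (MvPolynomial.X x)
  have hm : Function.Injective m := fun a b h =>
    mul_left_cancel₀ (MvPolynomial.X_ne_zero x) h
  have hrank : ∀ I' : Ideal (MvPolynomial τ K), gradedRank I' t =
      Module.finrank K ((I'.restrictScalars K ⊓ homogeneousSubmodule τ K t).map m) := fun I' =>
    ((Submodule.equivMapOfInjective m hm _).finrank_eq)
  have h1 : (supXMul J I x).restrictScalars K ⊓ homogeneousSubmodule τ K (t + 1) =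
      (J.restrictScalars K ⊓ homogeneousSubmodule τ K (t + 1)) ⊔
        (I.restrictScalars K ⊓ homogeneousSubmodule τ K t).map m := by
    ext f
    simp only [Submodule.mem_inf, Submodule.restrictScalars_mem, Submodule.mem_sup,
      Submodule.mem_map, mem_supXMul]
    constructor
    · rintro ⟨⟨j, hj, g, hg, rfl⟩, hf⟩
      have := homogeneousComponent_eq_self hf
      rw [map_add, homogeneousComponent_succ_X_mul] at this
      exact ⟨_, ⟨hJ j hj _, homogeneousComponent_mem _ _⟩, _,
        ⟨_, ⟨hI g hg t, homogeneousComponent_mem _ _⟩, rfl⟩, this⟩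
    · rintro ⟨j, ⟨hj, hj'⟩, _, ⟨g, ⟨hg, hg'⟩, rfl⟩, rfl⟩
      refine ⟨⟨j, hj, g, hg, rfl⟩, Submodule.add_mem _ hj' ?_⟩
      have := (isHomogeneous_X K x).mul hg'
      rwa [add_comm] at this
  have h2 : (J.restrictScalars K ⊓ homogeneousSubmodule τ K (t + 1)) ⊓
        (I.restrictScalars K ⊓ homogeneousSubmodule τ K t).map m =
      ((infXColon J I x).restrictScalars K ⊓ homogeneousSubmodule τ K t).map m := by
    ext f
    simp only [Submodule.mem_inf, Submodule.restrictScalars_mem,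
      Submodule.mem_map, mem_infXColon]
    constructor
    · rintro ⟨⟨hj, _⟩, g, ⟨hg, hg'⟩, rfl⟩
      exact ⟨g, ⟨⟨hg, hj⟩, hg'⟩, rfl⟩
    · rintro ⟨g, ⟨⟨hg, hj⟩, hg'⟩, rfl⟩
      refine ⟨⟨hj, ?_⟩, g, ⟨hg, hg'⟩, rfl⟩
      have := (isHomogeneous_X K x).mul hg'
      rwa [add_comm] at this
  have := Submodule.finrank_sup_add_finrank_inf_eq
    (J.restrictScalars K ⊓ homogeneousSubmodule τ K (t + 1))
    ((I.restrictScalars K ⊓ homogeneousSubmodule τ K t).map m)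
  rw [← h1, h2, ← hrank, ← hrank] at this
  exact this

/-- When all variables annihilate $I/J$, polynomials act on it through their constant terms. Hence
$I/J$ is spanned over $K$ by the generators of $I$ and vanishes beyond their degrees. -/
theorem homogeneousComponent_mem_of_X_mul_mem {J I : Ideal (MvPolynomial τ K)}
    (hJ : ∀ f ∈ J, ∀ t, homogeneousComponent t f ∈ J)
    (hX : ∀ i, ∀ f ∈ I, MvPolynomial.X i * f ∈ J) {t : ℕ} {s : Finset (MvPolynomial τ K)}
    (hs : Ideal.span (s : Set (MvPolynomial τ K)) = I) (ht : ∀ g ∈ s, g.totalDegree < t)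
    {f : MvPolynomial τ K} (hf : f ∈ I) : homogeneousComponent t f ∈ J := by
  have hX' : ∀ a : MvPolynomial τ K, ∀ g ∈ I, a * g - MvPolynomial.C (a.coeff 0) * g ∈ J := by
    intro a g hg
    induction a using MvPolynomial.induction_on with
    | C r => simp
    | add p q hp hq =>
      have := J.add_mem hp hq
      rw [MvPolynomial.coeff_add, map_add]
      convert this using 1
      ring
    | mul_X p i _ =>
      have : p * MvPolynomial.X i * g = MvPolynomial.X i * (p * g) := by ring
      rw [← constantCoeff_eq, map_mul, constantCoeff_X, mul_zero, map_zero, zero_mul, sub_zero, this]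
      exact hX i _ (I.mul_mem_left p hg)
  rw [← hs] at hf
  induction hf using Submodule.span_induction with
  | mem g hg =>
    rw [homogeneousComponent_eq_zero _ _ (ht g hg)]
    exact J.zero_mem
  | zero => rw [map_zero]; exact J.zero_mem
  | add p q _ _ hp hq => rw [map_add]; exact J.add_mem hp hq
  | smul a g hg ih =>
    replace hg : g ∈ I := hs ▸ hg
    have h1 := hJ _ (hX' a g hg) t
    rw [map_sub, homogeneousComponent_C_mul] at h1
    have h2 := J.add_mem h1 (J.mul_mem_left (MvPolynomial.C (a.coeff 0)) ih)
    rwa [sub_add_cancel] at h2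

/-- The Hilbert–Serre argument for the graded module $M=I/J$, by induction on the set of variables
that may act nontrivially. Multiplication by $x$ on $M$ has kernel `infXColon J I x` modulo $J$ and
cokernel $I$ modulo `supXMul J I x`; $x$ acts as zero on both. Subquotients of the polynomial ring
suffice, so every module in the induction is given by a pair of ideals. -/
theorem isHilbertSequence_gradedRank_sub [Finite τ] (T : Finset τ) :
    ∀ J I : Ideal (MvPolynomial τ K), J ≤ I →
      (∀ f ∈ J, ∀ t, homogeneousComponent t f ∈ J) →
      (∀ f ∈ I, ∀ t, homogeneousComponent t f ∈ I) →
      (∀ i ∉ T, ∀ f ∈ I, MvPolynomial.X i * f ∈ J) →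
      IsHilbertSequence fun t => (gradedRank I t : ℚ) - gradedRank J t := by
  classical
  induction T using Finset.induction_on with
  | empty =>
    intro J I hJI hJ hI hX
    obtain ⟨s, hs⟩ := (isNoetherianRing_iff_ideal_fg (MvPolynomial τ K)).mp inferInstance I
    refine .of_eventually_eq 0 (eventually_atTop.mpr ⟨s.sup totalDegree + 1, fun t ht => ?_⟩)
    have : I.restrictScalars K ⊓ homogeneousSubmodule τ K t =
        J.restrictScalars K ⊓ homogeneousSubmodule τ K t := by
      refine le_antisymm (fun f hf => ⟨?_, hf.2⟩) (inf_le_inf_right _ hJI)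
      have h1 := homogeneousComponent_mem_of_X_mul_mem hJ (fun i => hX i (Finset.notMem_empty i))
        hs (t := t) (fun g hg => lt_of_le_of_lt (Finset.le_sup hg) (by omega)) hf.1
      rwa [homogeneousComponent_eq_self hf.2] at h1
    rw [gradedRank, gradedRank, this, sub_self, Polynomial.eval_zero]
  | insert x T hx ih =>
    intro J I hJI hJ hI hX
    refine .of_sub (a := fun t => (gradedRank I t : ℚ) - gradedRank (supXMul J I x) t)
      (b := fun t => (gradedRank (infXColon J I x) t : ℚ) - gradedRank J t)
      (ih (supXMul J I x) I ?_ ?_ hI ?_) (ih J (infXColon J I x) ?_ hJ ?_ ?_) ?_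
    · intro f hf
      obtain ⟨j, hj, g, hg, rfl⟩ := mem_supXMul.mp hf
      exact I.add_mem (hJI hj) (I.mul_mem_left _ hg)
    · intro f hf t
      obtain ⟨j, hj, g, hg, rfl⟩ := mem_supXMul.mp hf
      rw [map_add]
      cases t with
      | zero =>
        exact mem_supXMul.mpr ⟨_, hJ j hj 0, 0, I.zero_mem, by
          rw [homogeneousComponent_zero_X_mul, mul_zero]⟩
      | succ t =>
        exact mem_supXMul.mpr ⟨_, hJ j hj _, _, hI g hg t, by
          rw [homogeneousComponent_succ_X_mul]⟩
    · intro i hi f hf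
      by_cases h : i = x
      · subst h
        exact mem_supXMul.mpr ⟨0, J.zero_mem, f, hf, zero_add _⟩
      · exact mem_supXMul.mpr ⟨_, hX i (by simp [h, hi]) f hf, 0, I.zero_mem, by simp⟩
    · exact fun f hf => mem_infXColon.mpr ⟨hJI hf, J.mul_mem_left _ hf⟩
    · intro f hf t
      obtain ⟨h1, h2⟩ := mem_infXColon.mp hf
      refine mem_infXColon.mpr ⟨hI f h1 t, ?_⟩
      rw [← homogeneousComponent_succ_X_mul]
      exact hJ _ h2 _
    · intro i hi f hf
      obtain ⟨h1, h2⟩ := mem_infXColon.mp hf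
      by_cases h : i = x
      · subst h; exact h2
      · exact hX i (by simp [h, hi]) f h1
    · intro t
      have h := gradedRank_supXMul x hJ hI t
      have h' : ((gradedRank (supXMul J I x) (t + 1) : ℚ) + gradedRank (infXColon J I x) t) =
        gradedRank J (t + 1) + gradedRank I t := by exact_mod_cast h
      linarith

/-- Every homogeneous ideal in finitely many variables has a Hilbert polynomial. -/
theorem eventually_eval_hilbertPolynomial [Finite τ] {I : Ideal (MvPolynomial τ K)}
    (hI : ∀ f ∈ I, ∀ t, homogeneousComponent t f ∈ I) :
    ∀ᶠ t : ℕ in atTop, (hilbertPolynomial I).eval (t : ℚ) = hilbertFunction I t := by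
  classical
  have := Fintype.ofFinite τ
  obtain ⟨P, hP⟩ := (isHilbertSequence_gradedRank_sub Finset.univ I ⊤ le_top hI
    (fun _ _ _ => Submodule.mem_top) (fun i hi => absurd (Finset.mem_univ i) hi)).exists_polynomial
  have h : ∃ P : ℚ[X], ∀ᶠ t : ℕ in atTop, P.eval (t : ℚ) = hilbertFunction I t := by
    refine ⟨P, hP.mono fun t ht => ?_⟩
    have h1 := hilbertFunction_add_gradedRank I t
    have h2 : gradedRank (⊤ : Ideal (MvPolynomial τ K)) t =
        Module.finrank K (homogeneousSubmodule τ K t) := by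
      rw [gradedRank, Submodule.restrictScalars_top, top_inf_eq]
    have h3 : (hilbertFunction I t : ℚ) + gradedRank I t = gradedRank (⊤ : Ideal (MvPolynomial τ K)) t := by
      rw [h2]; exact_mod_cast h1
    rw [ht]; linarith
  rw [hilbertPolynomial, dif_pos h]
  exact h.choose_spec

end Homogeneous

end VogelCycle
end

noncomputable section
namespace VogelCycle

open Polynomial Filter

/-! ### Affine Hilbert functions -/

section AffineRank

open MvPolynomial

variable {K : Type*} [Field K] {σ : Type*}

/-- The image in `K[x] / I` of the polynomials of degree at most `t`. -/
def degreeFiltration (I : Ideal (MvPolynomial σ K)) (t : ℕ) :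
    Submodule K (MvPolynomial σ K ⧸ I) :=
  (restrictTotalDegree σ K t).map (Ideal.Quotient.mkₐ K I).toLinearMap

/-- The affine Hilbert function of an ideal. -/
def affineRank (I : Ideal (MvPolynomial σ K)) (t : ℕ) : ℕ :=
  Module.finrank K (degreeFiltration I t)

theorem mk_mem_degreeFiltration (I : Ideal (MvPolynomial σ K)) {t : ℕ} {f : MvPolynomial σ K}
    (hf : f.totalDegree ≤ t) : Ideal.Quotient.mk I f ∈ degreeFiltration I t :=
  ⟨f, (mem_restrictTotalDegree σ t f).mpr hf, rfl⟩

theorem mem_degreeFiltration {I : Ideal (MvPolynomial σ K)} {t : ℕ} {x : MvPolynomial σ K ⧸ I} :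
    x ∈ degreeFiltration I t ↔ ∃ f : MvPolynomial σ K, f.totalDegree ≤ t ∧
      Ideal.Quotient.mk I f = x := by
  constructor
  · rintro ⟨f, hf, rfl⟩
    exact ⟨f, (mem_restrictTotalDegree σ t f).mp hf, rfl⟩
  · rintro ⟨f, hf, rfl⟩
    exact mk_mem_degreeFiltration I hf

theorem degreeFiltration_mono (I : Ideal (MvPolynomial σ K)) : Monotone (degreeFiltration I) := by
  intro s t hst x hx
  obtain ⟨f, hf, rfl⟩ := mem_degreeFiltration.mp hx
  exact mk_mem_degreeFiltration I (hf.trans hst)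

theorem restrictTotalDegree_eq_span (t : ℕ) : restrictTotalDegree σ K t =
    Submodule.span K ((fun a => MvPolynomial.monomial a (1 : K)) '' {a : σ →₀ ℕ | a.degree ≤ t}) := by
  refine le_antisymm (fun f hf => ?_) (Submodule.span_le.mpr ?_)
  · rw [mem_restrictTotalDegree] at hf
    rw [f.as_sum]
    refine Submodule.sum_mem _ fun a ha => ?_
    have : MvPolynomial.monomial a (coeff a f) = coeff a f • (MvPolynomial.monomial a (1 : K)) := by
      rw [MvPolynomial.smul_monomial, smul_eq_mul, mul_one]
    rw [this]
    refine Submodule.smul_mem _ _ (Submodule.subset_span ⟨a, ?_, rfl⟩)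
    exact (le_totalDegree ha).trans hf
  · rintro _ ⟨a, ha, rfl⟩
    exact (mem_restrictTotalDegree σ t _).mpr ((totalDegree_monomial_le a 1).trans ha)

/-- A monomial of degree at most $t$ becomes a form of degree $t$ after multiplication by a power of
$x_0$, which dehomogenization sends to $1$. -/
theorem map_dehomogenize_homogeneousSubmodule (t : ℕ) :
    (homogeneousSubmodule (Option σ) K t).map (dehomogenize K σ).toLinearMap =
      restrictTotalDegree σ K t := by
  apply le_antisymm
  · rintro _ ⟨F, hF, rfl⟩
    rw [F.as_sum]
    simp only [AlgHom.toLinearMap_apply, map_sum]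
    refine Submodule.sum_mem _ fun a ha => (mem_restrictTotalDegree σ t _).mpr ?_
    have hdeg : a.degree = t := by
      have := (mem_homogeneousSubmodule t F).mp hF
      by_contra hne
      exact (mem_support_iff.mp ha) (this.coeff_eq_zero hne)
    rw [dehomogenize, MvPolynomial.aeval_monomial]
    refine (totalDegree_mul _ _).trans ?_
    rw [algebraMap_eq, totalDegree_C, zero_add]
    refine (totalDegree_finsetProd _ _).trans ?_
    rw [← hdeg]
    refine Finset.sum_le_sum fun o _ => ?_
    refine (totalDegree_pow _ _).trans ?_
    cases o with
    | none => simp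
    | some i => simp
  · rw [restrictTotalDegree_eq_span, Submodule.span_le]
    rintro _ ⟨a, ha, rfl⟩
    refine ⟨MvPolynomial.X none ^ (t - a.degree) * rename some (MvPolynomial.monomial a 1), ?_, ?_⟩
    · have h1 := (isHomogeneous_X_pow (R := K) (none : Option σ) (t - a.degree)).mul
        (IsHomogeneous.rename_isHomogeneous (f := some) (isHomogeneous_monomial (1 : K) (d := a) rfl))
      rw [Nat.sub_add_cancel ha] at h1
      exact h1
    · simp only [dehomogenize, AlgHom.toLinearMap_apply, map_mul, map_pow, MvPolynomial.aeval_X,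
        Option.elim_none, one_pow, one_mul, aeval_rename]
      exact MvPolynomial.aeval_X_left_apply _

theorem closureIdeal_isHomogeneous (p : PrimeSpectrum (MvPolynomial σ K)) :
    ∀ F ∈ closureIdeal p, ∀ t, homogeneousComponent t F ∈ closureIdeal p := by
  let _ := MvPolynomial.gradedAlgebra (σ := Option σ) (R := K)
  have h : (closureIdeal p).IsHomogeneous (homogeneousSubmodule (Option σ) K) := by
    refine Ideal.homogeneous_span _ _ fun F hF => ?_
    obtain ⟨⟨t, ht⟩, _⟩ := hF
    exact ⟨t, ht⟩
  exact fun F hF t => homogeneousComponent_mem_of_mem h hF t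

theorem mem_closureIdeal_iff {p : PrimeSpectrum (MvPolynomial σ K)} {t : ℕ}
    {F : MvPolynomial (Option σ) K} (hF : F.IsHomogeneous t) :
    F ∈ closureIdeal p ↔ dehomogenize K σ F ∈ p.asIdeal := by
  refine ⟨fun h => ?_, fun h => Ideal.subset_span ⟨⟨t, hF⟩, h⟩⟩
  have : closureIdeal p ≤ p.asIdeal.comap (dehomogenize K σ) :=
    Ideal.span_le.mpr fun G hG => hG.2
  exact this h

variable [Finite σ]

instance finite_degreeFiltration (I : Ideal (MvPolynomial σ K)) (t : ℕ) :
    FiniteDimensional K (degreeFiltration I t) :=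
  inferInstanceAs (FiniteDimensional K
    ((restrictTotalDegree σ K t).map (Ideal.Quotient.mkₐ K I).toLinearMap))

/-- The forms of degree $t$ in the closure ideal are exactly those that vanish in $K[x]/p$ after
dehomogenization, so both sides have the same rank–nullity count. This replaces projective closures
by filtered affine coordinate rings. -/
theorem hilbertFunction_closureIdeal (p : PrimeSpectrum (MvPolynomial σ K)) (t : ℕ) :
    hilbertFunction (closureIdeal p) t = affineRank p.asIdeal t := by
  let ψ := (Ideal.Quotient.mkₐ K p.asIdeal).toLinearMap ∘ₗ (dehomogenize K σ).toLinearMap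
  have h1 := finrank_map_add_finrank_inf_ker (homogeneousSubmodule (Option σ) K t) ψ
  have h2 := hilbertFunction_add_gradedRank (closureIdeal p) t
  have h3 : (closureIdeal p).restrictScalars K ⊓ homogeneousSubmodule (Option σ) K t =
      homogeneousSubmodule (Option σ) K t ⊓ LinearMap.ker ψ := by
    ext F
    simp only [Submodule.mem_inf, Submodule.restrictScalars_mem, LinearMap.mem_ker,
      and_comm (a := F ∈ closureIdeal p)]
    refine and_congr_right fun hF => ?_
    rw [mem_closureIdeal_iff hF, ← Ideal.Quotient.eq_zero_iff_mem]
    rfl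
  rw [gradedRank, h3, ← h1] at h2
  rw [Nat.add_right_cancel h2, affineRank, degreeFiltration,
    ← map_dehomogenize_homogeneousSubmodule, Submodule.map_comp]

theorem eventually_eval_hilbertPolynomial_closureIdeal (p : PrimeSpectrum (MvPolynomial σ K)) :
    ∀ᶠ t : ℕ in atTop,
      (hilbertPolynomial (closureIdeal p)).eval (t : ℚ) = affineRank p.asIdeal t := by
  simpa only [hilbertFunction_closureIdeal] using
    eventually_eval_hilbertPolynomial (closureIdeal_isHomogeneous p)

theorem affineRank_mono (I : Ideal (MvPolynomial σ K)) : Monotone (affineRank I) :=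
  fun _ _ hst => Submodule.finrank_mono (degreeFiltration_mono I hst)

theorem affineRank_add_finrank (I : Ideal (MvPolynomial σ K)) (t : ℕ) :
    affineRank I t + Module.finrank K ↥(restrictTotalDegree σ K t ⊓ I.restrictScalars K) =
      Module.finrank K (restrictTotalDegree σ K t) := by
  rw [← finrank_map_add_finrank_inf_ker (restrictTotalDegree σ K t)
    (Ideal.Quotient.mkₐ K I).toLinearMap, affineRank, degreeFiltration]
  have : I.restrictScalars K = LinearMap.ker (Ideal.Quotient.mkₐ K I).toLinearMap := by
    ext x
    simp [Ideal.Quotient.eq_zero_iff_mem]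
  rw [this]

theorem affineRank_anti {I J : Ideal (MvPolynomial σ K)} (h : I ≤ J) (t : ℕ) :
    affineRank J t ≤ affineRank I t := by
  have h1 := affineRank_add_finrank I t
  have h2 := affineRank_add_finrank J t
  have h3 : Module.finrank K ↥(restrictTotalDegree σ K t ⊓ I.restrictScalars K) ≤
      Module.finrank K ↥(restrictTotalDegree σ K t ⊓ J.restrictScalars K) :=
    Submodule.finrank_mono (inf_le_inf_left _ h)
  omega

theorem finrank_map_mulLeft (I : Ideal (MvPolynomial σ K)) (u : MvPolynomial σ K) (s : ℕ)
    {P : Ideal (MvPolynomial σ K)} (hP : ∀ h, u * h ∈ I → h ∈ P) :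
    affineRank P s ≤ Module.finrank K ((restrictTotalDegree σ K s).map
      ((Ideal.Quotient.mkₐ K I).toLinearMap ∘ₗ LinearMap.mulLeft K u)) := by
  have h1 := finrank_map_add_finrank_inf_ker (restrictTotalDegree σ K s)
    ((Ideal.Quotient.mkₐ K I).toLinearMap ∘ₗ LinearMap.mulLeft K u)
  have h2 := affineRank_add_finrank P s
  have h3 : Module.finrank K ↥(restrictTotalDegree σ K s ⊓
      LinearMap.ker ((Ideal.Quotient.mkₐ K I).toLinearMap ∘ₗ LinearMap.mulLeft K u)) ≤
      Module.finrank K ↥(restrictTotalDegree σ K s ⊓ P.restrictScalars K) := by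
    refine Submodule.finrank_mono (inf_le_inf_left _ fun h hh => hP h ?_)
    rw [← Ideal.Quotient.eq_zero_iff_mem]
    exact hh
  omega

/-- Dividing out an element `u` of degree at most `r` lowers the Hilbert function at least by the
shifted Hilbert function of `K[x] / P` if `P` contains the annihilator of `u` modulo `I`. -/
theorem affineRank_sup_span_add_le {I P : Ideal (MvPolynomial σ K)} {u : MvPolynomial σ K}
    (hP : ∀ h, u * h ∈ I → h ∈ P) {r : ℕ} (hu : u.totalDegree ≤ r) (s : ℕ) :
    affineRank (I ⊔ Ideal.span {u}) (s + r) + affineRank P s ≤ affineRank I (s + r) := by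
  let π : (MvPolynomial σ K ⧸ I) →ₗ[K] MvPolynomial σ K ⧸ (I ⊔ Ideal.span {u}) :=
    (Ideal.Quotient.factorₐ K (le_sup_left : I ≤ I ⊔ Ideal.span {u})).toLinearMap
  have h1 := finrank_map_add_finrank_inf_ker (degreeFiltration I (s + r)) π
  have h2 : (degreeFiltration I (s + r)).map π =
      degreeFiltration (I ⊔ Ideal.span {u}) (s + r) := by
    rw [degreeFiltration, ← Submodule.map_comp]
    rfl
  rw [h2] at h1
  rw [affineRank, affineRank.eq_def I, ← h1]
  refine Nat.add_le_add_left ((finrank_map_mulLeft I u s hP).trans ?_) _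
  refine Submodule.finrank_mono ?_
  rintro _ ⟨h, hh, rfl⟩
  refine ⟨mk_mem_degreeFiltration I ?_, ?_⟩
  · have := (mem_restrictTotalDegree σ s h).mp hh
    refine (totalDegree_mul _ _).trans ?_
    omega
  · change Ideal.Quotient.mk (I ⊔ Ideal.span {u}) (u * h) = 0
    rw [Ideal.Quotient.eq_zero_iff_mem]
    exact Ideal.mul_mem_right _ _ (Ideal.mem_sup_right (Ideal.mem_span_singleton_self u))

end AffineRank

/-! ### Multiplicities -/

/-- Multiplication by $u$ gives an exact sequence $L/m\to L/a\to L/(a+(u))\to 0$. -/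
theorem length_quotient_le_add {L : Type*} [CommRing L] (a m : Ideal L) (u : L)
    (h : ∀ x ∈ m, x * u ∈ a) :
    Module.length L (L ⧸ a) ≤ Module.length L (L ⧸ (a ⊔ Ideal.span {u})) +
      Module.length L (L ⧸ m) := by
  let g : (L ⧸ a) →ₗ[L] L ⧸ (a ⊔ Ideal.span {u}) := Submodule.factor le_sup_left
  have hg : Function.Surjective g := Submodule.factor_surjective _
  let f : (L ⧸ m) →ₗ[L] (L ⧸ a) := Submodule.liftQ m (LinearMap.toSpanSingleton L _
    (Submodule.Quotient.mk u)) (fun x hx => by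
      rw [LinearMap.mem_ker, LinearMap.toSpanSingleton_apply, ← Submodule.Quotient.mk_smul,
        Submodule.Quotient.mk_eq_zero]
      exact h x hx)
  have hf : LinearMap.ker g ≤ LinearMap.range f := by
    intro x hx
    obtain ⟨y, rfl⟩ := Submodule.Quotient.mk_surjective _ x
    have hy : y ∈ a ⊔ Ideal.span {u} := by
      rw [LinearMap.mem_ker] at hx
      exact (Submodule.Quotient.mk_eq_zero _).mp hx
    obtain ⟨b, hb, c, hc, rfl⟩ := Submodule.mem_sup.mp hy
    obtain ⟨d, rfl⟩ := Ideal.mem_span_singleton'.mp hc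
    refine ⟨Submodule.Quotient.mk d, ?_⟩
    rw [Submodule.Quotient.mk_add, (Submodule.Quotient.mk_eq_zero a).mpr hb, zero_add]
    simp only [f, Submodule.liftQ_apply, LinearMap.toSpanSingleton_apply]
    rw [← Submodule.Quotient.mk_smul, smul_eq_mul]
  rw [Module.length_eq_add_of_exact (LinearMap.ker g).subtype g (Submodule.subtype_injective _) hg
    (LinearMap.exact_subtype_ker_map g), add_comm]
  refine add_le_add_right ((Module.length_le_of_injective (Submodule.inclusion hf)
    (Submodule.inclusion_injective _)).trans ?_) _
  exact Module.length_le_of_surjective f.rangeRestrict f.surjective_rangeRestrict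

/-- The length of the local ring of `V(I)` at `q`. -/
def localLength {R : Type*} [CommRing R] (I : Ideal R) (q : PrimeSpectrum R) : ℕ∞ :=
  Module.length (Localization.AtPrime q.asIdeal)
    (Localization.AtPrime q.asIdeal ⧸ I.map (algebraMap R (Localization.AtPrime q.asIdeal)))

/-- The element $r$ becomes a unit at $q$, so $u$ already lies in the localized ideal and adding it
changes nothing there. -/
theorem localLength_le_of_notMem {R : Type*} [CommRing R] {I : Ideal R} {q : PrimeSpectrum R}
    {u r : R} (hr : r ∉ q.asIdeal) (h : r * u ∈ I) :
    localLength I q ≤ localLength (I ⊔ Ideal.span {u}) q := by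
  have hu : algebraMap R (Localization.AtPrime q.asIdeal) u ∈
      I.map (algebraMap R (Localization.AtPrime q.asIdeal)) := by
    have h1 := Ideal.mem_map_of_mem (algebraMap R (Localization.AtPrime q.asIdeal)) h
    rw [map_mul] at h1
    exact (Ideal.unit_mul_mem_iff_mem _
      (IsLocalization.map_units (Localization.AtPrime q.asIdeal)
        (⟨r, hr⟩ : q.asIdeal.primeCompl))).mp h1
  have : (I ⊔ Ideal.span {u}).map (algebraMap R (Localization.AtPrime q.asIdeal)) =
      I.map (algebraMap R (Localization.AtPrime q.asIdeal)) := by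
    rw [Ideal.map_sup, Ideal.map_span, Set.image_singleton, sup_eq_left, Ideal.span_le]
    simpa using hu
  rw [localLength, localLength, this]

/-- What is lost by adding $u$ is generated by $u$ and killed by $q$, hence is a quotient of the
residue field at $q$. -/
theorem localLength_le_add_one {R : Type*} [CommRing R] {I : Ideal R} {q : PrimeSpectrum R}
    {u : R} (h : ∀ r ∈ q.asIdeal, r * u ∈ I) :
    localLength I q ≤ localLength (I ⊔ Ideal.span {u}) q + 1 := by
  let φ := algebraMap R (Localization.AtPrime q.asIdeal)
  have h1 := length_quotient_le_add (I.map φ) (q.asIdeal.map φ) (φ u) (by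
    intro x hx
    have : q.asIdeal.map φ ≤
        Submodule.comap (LinearMap.mulRight (Localization.AtPrime q.asIdeal) (φ u)) (I.map φ) := by
      refine Ideal.map_le_iff_le_comap.mpr fun r hr => ?_
      change φ r * φ u ∈ I.map φ
      rw [← map_mul]
      exact Ideal.mem_map_of_mem φ (h r hr)
    exact this hx)
  have h2 : Module.length (Localization.AtPrime q.asIdeal)
      (Localization.AtPrime q.asIdeal ⧸ q.asIdeal.map φ) = 1 := by
    rw [Localization.AtPrime.map_eq_maximalIdeal, Module.length_eq_one_iff,
      isSimpleModule_iff_isCoatom]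
    exact (IsLocalRing.maximalIdeal.isMaximal _).out
  rw [h2] at h1
  rw [localLength, localLength, Ideal.map_sup, Ideal.map_span, Set.image_singleton]
  exact h1

section Multiplicity

open MvPolynomial

variable {K : Type*} [Field K] {σ : Type*} [Finite σ]

/-- A prime filtration, built by Noetherian induction on $I$: an associated prime $P=(I:u)$ makes
the step from $I$ to $I+(u)$ cost a shifted copy of the Hilbert function of $K[x]/P$, while the
length at $q$ drops by at most one if $q=P$ and not at all otherwise. The ideal $J$ stays fixed so
that the primes in $S$ remain minimal over it while $I$ grows. The natural numbers $m_q$ also show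
that the lengths are finite. -/
theorem exists_sum_mul_affineRank_le (J : Ideal (MvPolynomial σ K))
    (S : Finset (PrimeSpectrum (MvPolynomial σ K)))
    (hS : ∀ q ∈ S, q.asIdeal ∈ J.minimalPrimes) (I : Ideal (MvPolynomial σ K)) (hJI : J ≤ I) :
    ∃ (c : ℕ) (m : PrimeSpectrum (MvPolynomial σ K) → ℕ),
      (∀ q ∈ S, localLength I q ≤ m q) ∧
      ∀ t, ∑ q ∈ S, m q * affineRank q.asIdeal t ≤ affineRank I (t + c) := by
  classical
  induction I using WellFoundedGT.induction with
  | ind I ih =>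
  by_cases hI : I = ⊤
  · refine ⟨0, 0, fun q _ => ?_, fun t => by simp⟩
    subst hI
    rw [localLength, Ideal.map_top, Module.length_eq_zero]
    exact zero_le
  · have hnt : Nontrivial (MvPolynomial σ K ⧸ I) := Ideal.Quotient.nontrivial_iff.mpr hI
    obtain ⟨P, hP, _⟩ := exists_le_isAssociatedPrime_of_isNoetherianRing (MvPolynomial σ K)
      (1 : MvPolynomial σ K ⧸ I) one_ne_zero
    obtain ⟨hPp, x, hx⟩ := isAssociatedPrime_iff.mp hP
    obtain ⟨u, rfl⟩ := Ideal.Quotient.mk_surjective x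
    have hcolon : ∀ h, h ∈ P ↔ h * u ∈ I := by
      intro h
      rw [hx, Submodule.mem_colon_singleton, Submodule.mem_bot, ← Ideal.Quotient.eq_zero_iff_mem,
        map_mul]
      rfl
    have hu : u ∉ I := fun hu => hPp.ne_top ((Ideal.eq_top_iff_one _).mpr
      ((hcolon 1).mpr (by rwa [one_mul])))
    have hlt : I < I ⊔ Ideal.span {u} := by
      refine lt_of_le_of_ne le_sup_left fun h => hu ?_
      rw [h]
      exact Ideal.mem_sup_right (Ideal.mem_span_singleton_self u)
    obtain ⟨c, m, hm, hc⟩ := ih _ hlt (hJI.trans hlt.le)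
    -- The shift accumulates the degrees of the elements `u` chosen along the filtration.
    refine ⟨c + u.totalDegree, fun q => m q + if q.asIdeal = P then 1 else 0, ?_, ?_⟩
    · intro q hq
      beta_reduce
      by_cases hqP : q.asIdeal = P
      · rw [if_pos hqP, Nat.cast_add, Nat.cast_one]
        refine (localLength_le_add_one fun r hr => (hcolon r).mp (hqP ▸ hr)).trans ?_
        gcongr
        exact hm q hq
      · rw [if_neg hqP, add_zero]
        -- $P$ contains $J$, so an inclusion $P\subseteq q$ would contradict the minimality of $q$;
        -- an element of $P$ outside $q$ then makes this step invisible at $q$.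
        have hle : ¬ P ≤ q.asIdeal := by
          intro hle
          refine hqP (le_antisymm ((hS q hq).2 ⟨hPp, ?_⟩ hle) hle)
          exact fun r hr => (hcolon r).mpr (I.mul_mem_right _ (hJI hr))
        obtain ⟨r, hr, hrq⟩ := Set.not_subset.mp hle
        exact (localLength_le_of_notMem hrq ((hcolon r).mp hr)).trans (hm q hq)
    · intro t
      have h1 : ∑ q ∈ S, (if q.asIdeal = P then 1 else 0) * affineRank q.asIdeal t ≤
          affineRank P t := by
        by_cases hex : ∃ q ∈ S, q.asIdeal = P
        · obtain ⟨q, hq, rfl⟩ := hex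
          rw [Finset.sum_eq_single_of_mem q hq]
          · simp
          · intro b _ hb
            rw [if_neg fun h => hb (PrimeSpectrum.ext h), zero_mul]
        · push Not at hex
          rw [Finset.sum_eq_zero fun q hq => by rw [if_neg (hex q hq), zero_mul]]
          exact Nat.zero_le _
      simp only [add_mul, Finset.sum_add_distrib]
      have h2 := affineRank_sup_span_add_le (I := I) (P := P) (u := u)
        (fun h hh => (hcolon h).mpr (by rwa [mul_comm])) (r := c + u.totalDegree)
        (Nat.le_add_left _ _) t
      have h3 := affineRank_mono (I ⊔ Ideal.span {u})
        (show t + c ≤ t + (c + u.totalDegree) by omega)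
      have h4 := hc t
      omega

/-! ### Degrees of scheme cycles from Hilbert function bounds -/

omit [Finite σ] in
theorem projDegree_eq_coeff {p : PrimeSpectrum (MvPolynomial σ K)} {e : ℕ}
    (h : (hilbertPolynomial (closureIdeal p)).natDegree = e) :
    projDegree (closureIdeal p) =
      (e.factorial : ℚ) * (hilbertPolynomial (closureIdeal p)).coeff e := by
  rw [projDegree, leadingCoeff, h]

theorem projDegree_closureIdeal_nonneg (p : PrimeSpectrum (MvPolynomial σ K)) :
    0 ≤ projDegree (closureIdeal p) :=
  mul_nonneg (by positivity) (leadingCoeff_nonneg_of_eventually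
    ((eventually_eval_hilbertPolynomial_closureIdeal p).mono fun t ht => by
      rw [ht]; positivity))

theorem natDegree_hilbertPolynomial_le {p : PrimeSpectrum (MvPolynomial σ K)} {U : ℚ[X]}
    (h : ∀ᶠ t : ℕ in atTop, (affineRank p.asIdeal t : ℚ) ≤ U.eval (t : ℚ)) :
    (hilbertPolynomial (closureIdeal p)).natDegree ≤ U.natDegree := by
  have h1 := eventually_eval_hilbertPolynomial_closureIdeal p
  refine natDegree_le_of_eventually_le (h1.mono fun t ht => ?_) ((h1.and h).mono fun t ht => ?_)
  · rw [ht]; positivity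
  · rw [ht.1]; exact ht.2

theorem coeff_taylor_of_natDegree_le {U : ℚ[X]} {e : ℕ} (hU : U.natDegree ≤ e) (c : ℚ) :
    (taylor c U).coeff e = U.coeff e := by
  rcases hU.lt_or_eq with h | rfl
  · rw [coeff_eq_zero_of_natDegree_lt h, coeff_eq_zero_of_natDegree_lt]
    rwa [natDegree_taylor]
  · have := leadingCoeff_taylor c U
    rwa [leadingCoeff, natDegree_taylor] at this

theorem degree_schemeCycle (J : Ideal (MvPolynomial σ K)) :
    ∃ S : Finset (PrimeSpectrum (MvPolynomial σ K)), (∀ q, q ∈ S ↔ q.asIdeal ∈ J.minimalPrimes) ∧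
      degree (schemeCycle J) =
        ∑ q ∈ S, ((localLength J q).toNat : ℚ) * projDegree (closureIdeal q) := by
  classical
  refine ⟨((J.finite_minimalPrimes_of_isNoetherianRing _).preimage
    (f := PrimeSpectrum.asIdeal) (fun _ _ _ _ h => PrimeSpectrum.ext h)).toFinset, ?_, ?_⟩
  · intro q
    simp
  · rw [degree, schemeCycle, Finsupp.onFinset_sum _ (fun _ => by simp)]
    refine Finset.sum_congr rfl fun q hq => ?_
    have hq' : q ∈ {q : PrimeSpectrum (MvPolynomial σ K) | q.asIdeal ∈ J.minimalPrimes} := by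
      simpa using hq
    rw [Set.indicator_of_mem hq']
    simp [multAlong, localLength]

/-- The degree of the cycle of a scheme with a Hilbert function bounded by a polynomial of degree
at most `e` all of whose components have dimension at least `e`. -/
theorem degree_schemeCycle_le (J : Ideal (MvPolynomial σ K)) (e : ℕ) (U : ℚ[X])
    (hU : U.natDegree ≤ e)
    (hJU : ∀ᶠ t : ℕ in atTop, (affineRank J t : ℚ) ≤ U.eval (t : ℚ))
    (hq : ∀ q : PrimeSpectrum (MvPolynomial σ K), q.asIdeal ∈ J.minimalPrimes →
      e ≤ (hilbertPolynomial (closureIdeal q)).natDegree) :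
    degree (schemeCycle J) ≤ (e.factorial : ℚ) * U.coeff e := by
  obtain ⟨S, hS, hdeg⟩ := degree_schemeCycle J
  -- The bound `U` on the Hilbert function of `J` also bounds that of each component, so every
  -- component has dimension exactly `e` and contributes to the coefficient of $t^e$.
  have hSe : ∀ q ∈ S, (hilbertPolynomial (closureIdeal q)).natDegree = e := by
    intro q hqS
    refine le_antisymm ((natDegree_hilbertPolynomial_le (hJU.mono fun t ht => ?_)).trans hU)
      (hq q ((hS q).mp hqS))
    exact le_trans (by exact_mod_cast affineRank_anti ((hS q).mp hqS).1.2 t) ht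
  obtain ⟨c, m, hm, hc⟩ := exists_sum_mul_affineRank_le J S (fun q h => (hS q).mp h) J le_rfl
  have h1 : (∑ q ∈ S, Polynomial.C (m q : ℚ) * hilbertPolynomial (closureIdeal q)).coeff e ≤
      (taylor (c : ℚ) U).coeff e := by
    refine coeff_le_coeff_of_eventually ?_ (by rwa [natDegree_taylor]) ?_
    · exact natDegree_sum_le_of_forall_le _ _ fun q hqS =>
        (natDegree_C_mul_le _ _).trans (hSe q hqS).le
    · have h2 : ∀ᶠ t : ℕ in atTop, ∀ q ∈ S, (hilbertPolynomial (closureIdeal q)).eval (t : ℚ) =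
          affineRank q.asIdeal t :=
        (Filter.eventually_all_finset S).mpr fun q _ =>
          eventually_eval_hilbertPolynomial_closureIdeal q
      have h3 := (tendsto_add_atTop_nat c).eventually hJU
      filter_upwards [h2, h3] with t ht2 ht3
      rw [eval_finsetSum, taylor_eval]
      calc ∑ q ∈ S, (Polynomial.C (m q : ℚ) * hilbertPolynomial (closureIdeal q)).eval (t : ℚ)
          = ((∑ q ∈ S, m q * affineRank q.asIdeal t : ℕ) : ℚ) := by
            push_cast
            refine Finset.sum_congr rfl fun q hqS => ?_
            rw [Polynomial.eval_mul, Polynomial.eval_C, ht2 q hqS]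
        _ ≤ affineRank J (t + c) := by exact_mod_cast hc t
        _ ≤ U.eval ((t : ℚ) + c) := by exact_mod_cast ht3
  rw [coeff_taylor_of_natDegree_le hU, finsetSum_coeff] at h1
  rw [hdeg]
  calc ∑ q ∈ S, ((localLength J q).toNat : ℚ) * projDegree (closureIdeal q)
      ≤ ∑ q ∈ S, (m q : ℚ) * projDegree (closureIdeal q) := by
        refine Finset.sum_le_sum fun q hqS => mul_le_mul_of_nonneg_right ?_
          (projDegree_closureIdeal_nonneg q)
        exact_mod_cast ENat.toNat_le_of_le_natCast (hm q hqS)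
    _ = (e.factorial : ℚ) *
        ∑ q ∈ S, (Polynomial.C (m q : ℚ) * hilbertPolynomial (closureIdeal q)).coeff e := by
        rw [Finset.mul_sum]
        refine Finset.sum_congr rfl fun q hqS => ?_
        rw [projDegree_eq_coeff (hSe q hqS), Polynomial.coeff_C_mul]
        ring
    _ ≤ (e.factorial : ℚ) * U.coeff e := mul_le_mul_of_nonneg_left h1 (by positivity)

end Multiplicity

end VogelCycle
end

noncomputable section
namespace VogelCycle

open Polynomial Filter

/-! ### Dimension -/

section Dimension

open MvPolynomial

variable {K : Type*} [Field K]

theorem finrank_submodule_mul_le {A : Type*} [CommRing A] [Algebra K A] (M N : Submodule K A)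
    [FiniteDimensional K M] [FiniteDimensional K N] :
    Module.finrank K ↥(M * N) ≤ Module.finrank K M * Module.finrank K N := by
  rw [← Submodule.mulMap_range, ← Module.finrank_tensorProduct (R := K) (S := K)]
  exact LinearMap.finrank_range_le _

theorem finrank_restrictTotalDegree_le (e t : ℕ) :
    Module.finrank K (restrictTotalDegree (Fin e) K t) ≤ (t + 1) ^ e := by
  have h : restrictTotalDegree (Fin e) K t ≤ Submodule.span K (Set.range fun a : Fin e → Fin (t + 1)
      => MvPolynomial.monomial (Finsupp.equivFunOnFinite.symm fun i => (a i : ℕ)) (1 : K)) := by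
    rw [restrictTotalDegree_eq_span]
    refine Submodule.span_mono ?_
    rintro _ ⟨a, ha, rfl⟩
    refine ⟨fun i => ⟨a i, Nat.lt_succ_iff.mpr ((Finsupp.le_degree i a).trans ha)⟩, ?_⟩
    beta_reduce
    congr 1
    exact congrArg _ (Finsupp.ext fun _ => rfl)
  have hfin := FiniteDimensional.span_of_finite K (Set.finite_range fun a : Fin e → Fin (t + 1) =>
    MvPolynomial.monomial (Finsupp.equivFunOnFinite.symm fun i => (a i : ℕ)) (1 : K))
  refine (Submodule.finrank_mono h).trans ((finrank_range_le_card _).trans (Eq.le ?_))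
  simp

theorem mul_submodule_mono {A : Type*} [CommRing A] [Algebra K A] {M M' N : Submodule K A}
    (h : M ≤ M') : M * N ≤ M' * N :=
  Submodule.mul_le.mpr fun _ ha _ hb => Submodule.mul_mem_mul (h ha) hb

variable {σ : Type*} [Finite σ]

/-- If `K[x] / I` contains a polynomial ring in `e` variables, then its Hilbert function grows at
least like a polynomial of degree `e`. -/
theorem exists_pow_le_affineRank {I : Ideal (MvPolynomial σ K)} {e : ℕ}
    (φ : MvPolynomial (Fin e) K →ₐ[K] MvPolynomial σ K ⧸ I) (hφ : Function.Injective φ) :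
    ∃ c, 0 < c ∧ ∀ t, (t + 1) ^ e ≤ affineRank I (c * t) := by
  choose y hy using fun k => Ideal.Quotient.mk_surjective (φ (MvPolynomial.X k))
  -- Lifts `y k` of the images of the variables, each raised to a power at most `t`, multiply to
  -- degree at most `t` times the sum of their degrees; the added `1` keeps the constant positive.
  refine ⟨∑ k, (y k).totalDegree + 1, Nat.succ_pos _, fun t => ?_⟩
  let ex : (Fin e → Fin (t + 1)) → (Fin e →₀ ℕ) := fun a =>
    Finsupp.equivFunOnFinite.symm fun i => (a i : ℕ)
  have hex : Function.Injective ex := by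
    intro a b hab
    funext i
    exact Fin.ext (DFunLike.congr_fun hab i)
  have hli : LinearIndependent K fun a => φ (MvPolynomial.monomial (ex a) 1) :=
    ((basisMonomials (Fin e) K).linearIndependent.comp ex hex).map' φ.toLinearMap
      (LinearMap.ker_eq_bot.mpr hφ)
  have hmem : ∀ a, φ (MvPolynomial.monomial (ex a) 1) ∈
      degreeFiltration I ((∑ k, (y k).totalDegree + 1) * t) := by
    intro a
    have h1 : φ (MvPolynomial.monomial (ex a) 1) =
        Ideal.Quotient.mk I (∏ k, y k ^ (a k : ℕ)) := by
      rw [MvPolynomial.monomial_eq, MvPolynomial.C_1, one_mul, Finsupp.prod_fintype _ _ (by simp),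
        map_prod, map_prod]
      refine Finset.prod_congr rfl fun k _ => ?_
      rw [map_pow, map_pow, hy]
      rfl
    rw [h1]
    refine mk_mem_degreeFiltration I ((totalDegree_finsetProd _ _).trans ?_)
    rw [add_mul, Finset.sum_mul]
    refine le_trans (Finset.sum_le_sum fun k _ => ?_) (Nat.le_add_right _ _)
    refine (totalDegree_pow _ _).trans ?_
    rw [mul_comm]
    exact Nat.mul_le_mul_left _ (Nat.lt_succ_iff.mp (a k).2)
  have hli' : LinearIndependent K fun a => (⟨_, hmem a⟩ :
      degreeFiltration I ((∑ k, (y k).totalDegree + 1) * t)) :=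
    LinearIndependent.of_comp (Submodule.subtype _) hli
  have := hli'.fintype_card_le_finrank
  simpa [affineRank] using this

theorem le_natDegree_of_injective {p : PrimeSpectrum (MvPolynomial σ K)} {e : ℕ}
    (φ : MvPolynomial (Fin e) K →ₐ[K] MvPolynomial σ K ⧸ p.asIdeal) (hφ : Function.Injective φ) :
    e ≤ (hilbertPolynomial (closureIdeal p)).natDegree := by
  obtain ⟨c, hc, h⟩ := exists_pow_le_affineRank φ hφ
  have h1 : Tendsto (fun t : ℕ => c * t) atTop atTop :=
    -- Rescaling the argument by a positive constant leaves the degree of the Hilbert polynomial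
    -- unchanged in the comparison below.
    tendsto_id.const_mul_atTop' hc
  have h2 := h1.eventually (eventually_eval_hilbertPolynomial_closureIdeal p)
  have h3 : ((Polynomial.X + 1 : ℚ[X]) ^ e).natDegree ≤
      ((hilbertPolynomial (closureIdeal p)).comp
        (Polynomial.C (c : ℚ) * Polynomial.X)).natDegree := by
    refine natDegree_le_of_eventually_le (Eventually.of_forall fun t => ?_)
      (h2.mono fun t ht => ?_)
    · simp only [Polynomial.eval_pow, Polynomial.eval_add, Polynomial.eval_X, Polynomial.eval_one]
      positivity
    · simp only [Polynomial.eval_pow, Polynomial.eval_add, Polynomial.eval_X, Polynomial.eval_one,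
        Polynomial.eval_comp, Polynomial.eval_mul, Polynomial.eval_C]
      rw [← Nat.cast_mul, ht]
      exact_mod_cast h t
  rw [natDegree_comp, natDegree_C_mul_X _ (by exact_mod_cast hc.ne'), mul_one, natDegree_pow,
    show (Polynomial.X + 1 : ℚ[X]) = Polynomial.X + Polynomial.C 1 by simp, natDegree_X_add_C,
    mul_one] at h3
  exact h3

/-- If `K[x] / I` is finite over a polynomial ring in `e` variables, then its Hilbert function
grows at most like a polynomial of degree `e`. -/
theorem exists_affineRank_le {I : Ideal (MvPolynomial σ K)} {e : ℕ}
    (φ : MvPolynomial (Fin e) K →ₐ[K] MvPolynomial σ K ⧸ I) (hφ : φ.Finite) :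
    ∃ m c, ∀ t, affineRank I t ≤ (c * (t + 1) + 1) ^ e * m := by
  have := Fintype.ofFinite σ
  let F : ℕ → Submodule K (MvPolynomial σ K ⧸ I) := fun t =>
    (restrictTotalDegree (Fin e) K t).map φ.toLinearMap
  have hFm : ∀ s t, F s * F t ≤ F (s + t) := by
    intro s t
    refine Submodule.mul_le.mpr ?_
    rintro _ ⟨a, ha, rfl⟩ _ ⟨b, hb, rfl⟩
    refine ⟨a * b, (mem_restrictTotalDegree _ _ _).mpr ?_, map_mul φ a b⟩
    exact (totalDegree_mul _ _).trans
      (add_le_add ((mem_restrictTotalDegree _ _ _).mp ha) ((mem_restrictTotalDegree _ _ _).mp hb))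
  have hFmono : Monotone F := by
    rintro s t hst _ ⟨a, ha, rfl⟩
    exact ⟨a, (mem_restrictTotalDegree _ _ _).mpr
      (((mem_restrictTotalDegree _ _ _).mp ha).trans hst), rfl⟩
  obtain ⟨G, hG⟩ : ∃ G : Finset (MvPolynomial σ K ⧸ I), ∀ x, ∃ t,
      x ∈ F t * Submodule.span K (G : Set (MvPolynomial σ K ⧸ I)) := by
    let _ : Module (MvPolynomial (Fin e) K) (MvPolynomial σ K ⧸ I) :=
      Module.compHom _ φ.toRingHom
    have hfin : Module.Finite (MvPolynomial (Fin e) K) (MvPolynomial σ K ⧸ I) := hφ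
    obtain ⟨G, hG⟩ := hfin.fg_top
    refine ⟨G, fun x => ?_⟩
    have hx : x ∈ Submodule.span (MvPolynomial (Fin e) K) (G : Set (MvPolynomial σ K ⧸ I)) :=
      hG ▸ Submodule.mem_top
    induction hx using Submodule.span_induction with
    | mem g hg =>
      refine ⟨0, ?_⟩
      have h1 : (1 : MvPolynomial σ K ⧸ I) ∈ F 0 :=
        ⟨1, (mem_restrictTotalDegree _ _ _).mpr (by simp), map_one φ⟩
      have := Submodule.mul_mem_mul h1 (Submodule.subset_span (R := K) hg)
      rwa [one_mul] at this
    | zero => exact ⟨0, Submodule.zero_mem _⟩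
    | add a b _ _ ha hb =>
      obtain ⟨s, hs⟩ := ha
      obtain ⟨t, ht⟩ := hb
      exact ⟨max s t, Submodule.add_mem _
        (mul_submodule_mono (hFmono (le_max_left s t)) hs)
        (mul_submodule_mono (hFmono (le_max_right s t)) ht)⟩
    | smul r a _ ha =>
      obtain ⟨s, hs⟩ := ha
      refine ⟨r.totalDegree + s, ?_⟩
      have h1 : φ r ∈ F r.totalDegree := ⟨r, (mem_restrictTotalDegree _ _ _).mpr le_rfl, rfl⟩
      have h2 := Submodule.mul_mem_mul h1 hs
      rw [← mul_assoc] at h2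
      exact mul_submodule_mono (hFm _ _) h2
  set Γ := Submodule.span K (G : Set (MvPolynomial σ K ⧸ I)) with hΓ
  choose τ hτ using hG
  let ξ : σ → MvPolynomial σ K ⧸ I := fun i => Ideal.Quotient.mk I (MvPolynomial.X i)
  -- One constant with $1\in F_c\Gamma$ and $\xi_i g\in F_c\Gamma$ for all coordinates $\xi_i$ and
  -- generators $g$. Each multiplication by a coordinate then raises the index of $F$ by `c`, so a
  -- monomial of degree $k$ lies in $F_{c(k+1)}\Gamma$, the extra `c` paying for the element $1$.
  let c := τ 1 + ∑ i, ∑ g ∈ G, τ (ξ i * g)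
  have hx : ∀ i, ∀ g ∈ Γ, ξ i * g ∈ F c * Γ := by
    intro i g hg
    have : Γ ≤ (F c * Γ).comap (LinearMap.mulLeft K (ξ i)) := by
      rw [hΓ, Submodule.span_le]
      intro g hg
      refine mul_submodule_mono (hFmono ?_) (hτ (ξ i * g))
      exact le_trans (Finset.single_le_sum (f := fun g => τ (ξ i * g)) (fun _ _ => Nat.zero_le _) hg)
        ((Finset.single_le_sum (f := fun i => ∑ g ∈ G, τ (ξ i * g)) (fun _ _ => Nat.zero_le _)
          (Finset.mem_univ i)).trans (Nat.le_add_left _ _))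
    exact this hg
  have hstep : ∀ i s, ∀ w ∈ F s * Γ, ξ i * w ∈ F (s + c) * Γ := by
    intro i s w hw
    refine Submodule.mul_induction_on hw (fun a ha g hg => ?_) fun a b ha hb => ?_
    · have h1 := Submodule.mul_mem_mul ha (hx i g hg)
      rw [← mul_assoc] at h1
      rw [mul_left_comm]
      exact mul_submodule_mono (hFm s c) h1
    · rw [mul_add]; exact Submodule.add_mem _ ha hb
  have hmon : ∀ a : σ →₀ ℕ, Ideal.Quotient.mk I (MvPolynomial.monomial a 1) ∈
      F (c * (a.degree + 1)) * Γ := by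
    intro a
    induction hn : a.degree generalizing a with
    | zero =>
      rw [(Finsupp.degree_eq_zero_iff a).mp hn]
      have hc : τ 1 ≤ c * (0 + 1) := by
        rw [zero_add, mul_one]
        exact Nat.le_add_right _ _
      exact mul_submodule_mono (hFmono hc) (hτ 1)
    | succ n ih =>
      obtain ⟨i, hi⟩ : ∃ i, a i ≠ 0 := by
        by_contra! h
        rw [show a = 0 from Finsupp.ext h] at hn
        simp at hn
      have ha : a - Finsupp.single i 1 + Finsupp.single i 1 = a :=
        tsub_add_cancel_of_le (Finsupp.single_le_iff.mpr (Nat.one_le_iff_ne_zero.mpr hi))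
      have hd : (a - Finsupp.single i 1).degree = n := by
        rw [← ha, map_add, Finsupp.degree_single] at hn
        omega
      have h1 := hstep i _ _ (ih _ hd)
      have h2 : MvPolynomial.monomial a (1 : K) =
          MvPolynomial.X i * MvPolynomial.monomial (a - Finsupp.single i 1) 1 := by
        rw [MvPolynomial.X, MvPolynomial.monomial_mul, one_mul, add_comm, ha]
      rw [h2, map_mul, mul_add, mul_one]
      exact h1
  have hle : ∀ t, degreeFiltration I t ≤ F (c * (t + 1)) * Γ := by
    intro t
    rw [degreeFiltration, restrictTotalDegree_eq_span, Submodule.map_span, Submodule.span_le]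
    rintro _ ⟨_, ⟨a, ha, rfl⟩, rfl⟩
    exact mul_submodule_mono (hFmono (Nat.mul_le_mul_left _ (Nat.succ_le_succ ha))) (hmon a)
  refine ⟨Module.finrank K Γ, c, fun t => ?_⟩
  have hΓfin : FiniteDimensional K Γ := FiniteDimensional.span_finset K G
  have hFfin : FiniteDimensional K (F (c * (t + 1))) := inferInstanceAs (FiniteDimensional K
    ((restrictTotalDegree (Fin e) K (c * (t + 1))).map φ.toLinearMap))
  have hfin : FiniteDimensional K ↥(F (c * (t + 1)) * Γ) := Module.Finite.iff_fg.mpr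
    ((Module.Finite.iff_fg.mp hFfin).mul (Module.Finite.iff_fg.mp hΓfin))
  refine (Submodule.finrank_mono (hle t)).trans ((finrank_submodule_mul_le _ _).trans ?_)
  exact Nat.mul_le_mul_right _ ((Submodule.finrank_map_le _ _).trans
    (finrank_restrictTotalDegree_le _ _))

theorem natDegree_le_of_finite {p : PrimeSpectrum (MvPolynomial σ K)} {e : ℕ}
    (φ : MvPolynomial (Fin e) K →ₐ[K] MvPolynomial σ K ⧸ p.asIdeal) (hφ : φ.Finite) :
    (hilbertPolynomial (closureIdeal p)).natDegree ≤ e := by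
  obtain ⟨m, c, h⟩ := exists_affineRank_le φ hφ
  refine (natDegree_hilbertPolynomial_le (U := (Polynomial.C (c : ℚ) * (Polynomial.X + 1) + 1) ^ e *
    Polynomial.C (m : ℚ)) (Eventually.of_forall fun t => ?_)).trans ?_
  · simp only [Polynomial.eval_pow, Polynomial.eval_add, Polynomial.eval_X, Polynomial.eval_one,
        Polynomial.eval_mul, Polynomial.eval_C]
    exact_mod_cast h t
  · refine (natDegree_mul_C_le _ _).trans (natDegree_pow_le.trans ?_)
    refine (Nat.mul_le_mul_left e ?_).trans (mul_one e).le
    compute_degree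

/-- Noether normalization, with the dimension read off from the Hilbert polynomial. -/
theorem exists_finite_injective (p : PrimeSpectrum (MvPolynomial σ K)) :
    ∃ φ : MvPolynomial (Fin (hilbertPolynomial (closureIdeal p)).natDegree) K →ₐ[K]
      MvPolynomial σ K ⧸ p.asIdeal, Function.Injective φ ∧ φ.Finite := by
  obtain ⟨e, φ, hinj, hfin⟩ := exists_finite_inj_algHom_of_fg K (MvPolynomial σ K ⧸ p.asIdeal)
  obtain rfl := le_antisymm (le_natDegree_of_injective φ hinj) (natDegree_le_of_finite φ hfin)
  exact ⟨φ, hinj, hfin⟩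

end Dimension

end VogelCycle
end

noncomputable section
namespace VogelCycle

open Polynomial Filter

/-! ### Hyperplane sections -/

section Cut

open MvPolynomial

variable {K : Type*} [Field K]

/-- Going down holds because $S$ is integrally closed and $A$ is a domain finite over it; the height
of $Q$ is then that of its contraction plus a fibre term. -/
theorem height_comap_le_of_finite {S A : Type*} [CommRing S] [IsNoetherianRing S]
    [IsIntegrallyClosed S] [CommRing A] [IsDomain A] [IsNoetherianRing A] (φ : S →+* A)
    (hφ : Function.Injective φ) (hfin : φ.Finite) (Q : Ideal A) [Q.IsPrime] :
    (Q.comap φ).height ≤ Q.height := by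
  let _ : Algebra S A := φ.toAlgebra
  have : FaithfulSMul S A := (faithfulSMul_iff_algebraMap_injective _ _).mpr hφ
  have : Module.Finite S A := hfin
  have : Q.LiesOver (Q.comap φ) := ⟨rfl⟩
  rw [Ideal.height_eq_height_add_of_liesOver_of_hasGoingDown (Q.comap φ) Q]
  exact le_self_add

theorem exists_pos_degreeOf {e : ℕ} {h : MvPolynomial (Fin e) K} (h0 : h ≠ 0) (hu : ¬ IsUnit h) :
    ∃ i, degreeOf i h ≠ 0 := by
  by_contra! hd
  have hdeg : h.totalDegree = 0 := by
    rw [totalDegree_eq_zero_iff]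
    intro m hm i
    exact Nat.le_zero.mp ((degreeOf_le_iff.mp (hd i).le) m hm)
  rw [totalDegree_eq_zero_iff_eq_C] at hdeg
  refine hu ?_
  rw [hdeg]
  refine (isUnit_iff_ne_zero.mpr fun hc => h0 ?_).map _
  rw [hdeg, hc, map_zero]

/-- A prime ideal of height at most one in a polynomial ring in `e + 1` variables does not contain
nonzero polynomials in suitable `e` of the variables. -/
theorem exists_forall_rename_mem_imp {e : ℕ} (P : Ideal (MvPolynomial (Fin (e + 1)) K)) [P.IsPrime]
    (hP : P.height ≤ 1) :
    ∃ i : Fin (e + 1), ∀ w : MvPolynomial (Fin e) K, rename i.succAbove w ∈ P → w = 0 := by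
  by_cases hbot : P = ⊥
  · refine ⟨0, fun w hw => ?_⟩
    rw [hbot, Ideal.mem_bot] at hw
    exact rename_injective _ (Fin.succAbove_right_injective) (hw.trans (map_zero _).symm)
  · obtain ⟨h, hhP, hh⟩ := Ideal.IsPrime.exists_mem_prime_of_ne_bot ‹_› hbot
    -- The variable to be dropped is one that occurs in `h`: since $P=(h)$, every nonzero element of
    -- $P$ has positive degree in it.
    obtain ⟨i, hi⟩ := exists_pos_degreeOf hh.ne_zero hh.not_isUnit
    have hprime : (Ideal.span {h}).IsPrime := (Ideal.span_singleton_prime hh.ne_zero).mpr hh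
    have hle : Ideal.span {h} ≤ P := (Ideal.span_singleton_le_iff_mem _).mpr hhP
    have heq : P = Ideal.span {h} := by
      by_contra hne
      have h1 := Ideal.height_add_one_le_of_lt_of_isPrime (lt_of_le_of_ne hle (Ne.symm hne))
      have h2 : (Ideal.span {h}).height ≠ 0 := by
        rw [Ne, Ideal.height_eq_zero_iff_eq_bot, Ideal.span_singleton_eq_bot]
        exact hh.ne_zero
      have h3 := Order.one_le_iff_pos.mpr (pos_iff_ne_zero.mpr h2)
      have h4 : (2 : ℕ∞) ≤ 1 := by
        calc (2 : ℕ∞) = 1 + 1 := by norm_num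
          _ ≤ (Ideal.span {h}).height + 1 := by gcongr
          _ ≤ 1 := h1.trans hP
      exact absurd h4 (by decide)
    refine ⟨i, fun w hw => ?_⟩
    by_contra hw0
    rw [heq, Ideal.mem_span_singleton'] at hw
    obtain ⟨v, hv⟩ := hw
    have hrw : rename i.succAbove w ≠ 0 := fun h0 =>
      hw0 (rename_injective _ (Fin.succAbove_right_injective) (h0.trans (map_zero _).symm))
    have hv0 : v ≠ 0 := by
      rintro rfl
      exact hrw (by rw [← hv, zero_mul])
    have h1 : degreeOf i (rename i.succAbove w) = 0 := by
      refine Nat.le_zero.mp (degreeOf_le_iff.mpr fun m hm => Nat.le_zero.mpr ?_)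
      by_contra hmi
      classical
      have hvars : i ∈ (rename i.succAbove w).vars :=
        (mem_vars_iff_mem_support i).mpr ⟨m, hm, Finsupp.mem_support_iff.mpr hmi⟩
      have := vars_rename i.succAbove w hvars
      obtain ⟨j, _, hj⟩ := Finset.mem_image.mp this
      exact Fin.succAbove_ne i j hj
    rw [← hv, degreeOf_mul_eq hv0 hh.ne_zero] at h1
    omega

variable {σ : Type*} [Finite σ]

/-- By Krull's principal ideal theorem $q/p$ has height at most one in $K[x]/p$, and so has its
contraction to a Noether normalization in $e+1$ variables. Some $e$ of these variables therefore
stay algebraically independent modulo $q$. -/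
theorem le_natDegree_of_mem_minimalPrimes {p q : PrimeSpectrum (MvPolynomial σ K)}
    {f : MvPolynomial σ K} (hq : q.asIdeal ∈ (p.asIdeal ⊔ Ideal.span {f}).minimalPrimes) {e : ℕ}
    (hp : (hilbertPolynomial (closureIdeal p)).natDegree = e + 1) :
    e ≤ (hilbertPolynomial (closureIdeal q)).natDegree := by
  have hex := exists_finite_injective p
  rw [hp] at hex
  obtain ⟨φ, hφ, hfin⟩ := hex
  have hpq : p.asIdeal ≤ q.asIdeal := le_sup_left.trans hq.1.2
  let mk := Ideal.Quotient.mk p.asIdeal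
  have hmk : Function.Surjective mk := Ideal.Quotient.mk_surjective
  have hker : RingHom.ker mk ≤ q.asIdeal := by rwa [Ideal.mk_ker]
  have hQ : (q.asIdeal.map mk).IsPrime := Ideal.map_isPrime_of_surjective hmk hker
  have hQmem : ∀ x, mk x ∈ q.asIdeal.map mk ↔ x ∈ q.asIdeal := fun x => by
    rw [← Ideal.mem_comap, Ideal.comap_map_of_surjective' mk hmk, sup_eq_left.mpr hker]
  have hheight : (q.asIdeal.map mk).height ≤ 1 := Ideal.map_height_le_one_of_mem_minimalPrimes hq
  let P := (q.asIdeal.map mk).comap φ.toRingHom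
  have hPp : P.IsPrime := inferInstance
  have hP : P.height ≤ 1 :=
    (height_comap_le_of_finite φ.toRingHom hφ hfin _).trans hheight
  obtain ⟨i, hi⟩ := exists_forall_rename_mem_imp P hP
  refine le_natDegree_of_injective (((Ideal.Quotient.factorₐ K hpq).comp φ).comp
    (rename i.succAbove)) ((injective_iff_map_eq_zero _).mpr fun w hw => hi w ?_)
  change φ (rename i.succAbove w) ∈ q.asIdeal.map mk
  obtain ⟨x, hx⟩ := hmk (φ (rename i.succAbove w))
  rw [← hx, hQmem, ← Ideal.Quotient.eq_zero_iff_mem, ← hw]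
  simp only [AlgHom.comp_apply]
  rw [← hx]
  rfl

/-- The exponent is one more than the dimension, so the value of the numerator at $1$ reads off the
coefficient in exactly the top degree of the Hilbert polynomial. -/
theorem exists_generating_polynomial (p : PrimeSpectrum (MvPolynomial σ K)) :
    ∃ N : ℚ[X], (N : PowerSeries ℚ) =
        (1 - PowerSeries.X) ^ ((hilbertPolynomial (closureIdeal p)).natDegree + 1) *
          PowerSeries.mk (fun t => (affineRank p.asIdeal t : ℚ)) ∧
      N.eval 1 = projDegree (closureIdeal p) := by
  obtain ⟨N, hN⟩ := exists_polynomial_eq_one_sub_pow_mul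
    ((hilbertPolynomial (closureIdeal p)).natDegree + 1)
    (fun t => (affineRank p.asIdeal t : ℚ)) (hilbertPolynomial (closureIdeal p))
    (lt_of_le_of_lt degree_le_natDegree (by exact_mod_cast Nat.lt_succ_self _))
    (eventually_eval_hilbertPolynomial_closureIdeal p)
  refine ⟨N, hN, ?_⟩
  have h1 : hilbertPoly N ((hilbertPolynomial (closureIdeal p)).natDegree + 1) =
      hilbertPolynomial (closureIdeal p) := eq_of_eventually_eval_eq (by
    filter_upwards [eventually_eval_hilbertPoly hN,
      eventually_eval_hilbertPolynomial_closureIdeal p] with t h1 h2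
    rw [h1, h2])
  rw [← coeff_hilbertPoly_succ N (hilbertPolynomial (closureIdeal p)).natDegree, h1,
    projDegree_eq_coeff rfl]

theorem affineRank_eq_zero {I : Ideal (MvPolynomial σ K)} {t : ℕ} (h : affineRank I t = 0) :
    I = ⊤ := by
  rw [affineRank, Submodule.finrank_eq_zero] at h
  have h1 := mk_mem_degreeFiltration I (t := t) (f := 1) (by simp)
  rw [h, Submodule.mem_bot, Ideal.Quotient.eq_zero_iff_mem] at h1
  exact (Ideal.eq_top_iff_one I).mpr h1

theorem degree_schemeCycle_top :
    degree (schemeCycle (⊤ : Ideal (MvPolynomial σ K))) = 0 := by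
  obtain ⟨S, hS, h⟩ := degree_schemeCycle (⊤ : Ideal (MvPolynomial σ K))
  rw [h]
  refine Finset.sum_eq_zero fun q hq => absurd ((hS q).mp hq).1.2 ?_
  rw [top_le_iff]
  exact q.2.ne_top

omit [Finite σ] in
theorem degree_single (p : PrimeSpectrum (MvPolynomial σ K)) (a : ℤ) :
    degree (Finsupp.single p a) = a * projDegree (closureIdeal p) := by
  rw [degree, Finsupp.sum_single_index]
  simp

/-- Cutting a variety with a hyperplane does not increase the degree. -/
theorem degree_cutPrime_le (p : PrimeSpectrum (MvPolynomial σ K)) {f : MvPolynomial σ K}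
    (hf : f.totalDegree ≤ 1) : degree (cutPrime p f) ≤ projDegree (closureIdeal p) := by
  rw [cutPrime]
  split_ifs with hfp
  · rw [degree_single, Int.cast_one, one_mul]
  · obtain ⟨N, hN, hN1⟩ := exists_generating_polynomial p
    set d := (hilbertPolynomial (closureIdeal p)).natDegree with hd
    -- The first difference of the Hilbert function has the same numerator `N` over $(1-X)^d$, and
    -- hence the same normalized top coefficient one degree lower.
    let g : ℕ → ℚ := fun t => PowerSeries.coeff t ((1 - PowerSeries.X) *
      PowerSeries.mk (fun t => (affineRank p.asIdeal t : ℚ)))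
    have hg : (N : PowerSeries ℚ) = (1 - PowerSeries.X) ^ d * PowerSeries.mk g := by
      rw [hN, pow_succ, mul_assoc]
      congr 1
      ext k
      simp [g]
    have hJ : ∀ᶠ t : ℕ in atTop, (affineRank (p.asIdeal ⊔ Ideal.span {f}) t : ℚ) ≤
        (hilbertPoly N d).eval (t : ℚ) := by
      filter_upwards [eventually_eval_hilbertPoly hg, eventually_ge_atTop 1] with t ht h1
      obtain ⟨s, rfl⟩ := Nat.exists_eq_add_of_le' h1
      have h2 := affineRank_sup_span_add_le (I := p.asIdeal) (P := p.asIdeal) (u := f)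
        (fun h hh => (p.2.mem_or_mem hh).resolve_left hfp) hf s
      have h3 : g (s + 1) = affineRank p.asIdeal (s + 1) - affineRank p.asIdeal s := by
        simp only [g, sub_mul, one_mul, map_sub, PowerSeries.coeff_succ_X_mul,
          PowerSeries.coeff_mk]
      have h4 : (affineRank (p.asIdeal ⊔ Ideal.span {f}) (s + 1) : ℚ) + affineRank p.asIdeal s ≤
        affineRank p.asIdeal (s + 1) := by exact_mod_cast h2
      rw [ht, h3]
      linarith
    -- For a variety of dimension zero the difference eventually vanishes, so the ideal of the
    -- section is the unit ideal and the cycle is zero.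
    rcases Nat.eq_zero_or_pos d with h0 | h0
    · rw [h0] at hJ
      obtain ⟨t, ht⟩ := hJ.exists
      rw [hilbertPoly_zero_right, Polynomial.eval_zero] at ht
      have : affineRank (p.asIdeal ⊔ Ideal.span {f}) t = 0 := by
        exact_mod_cast le_antisymm ht (by positivity)
      rw [affineRank_eq_zero this, degree_schemeCycle_top]
      exact projDegree_closureIdeal_nonneg p
    · obtain ⟨e, he⟩ := Nat.exists_eq_add_of_le' h0
      rw [he] at hJ
      rw [← hN1, ← coeff_hilbertPoly_succ N e]
      exact degree_schemeCycle_le _ e _ (natDegree_hilbertPoly_succ_le N e) hJ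
        fun q hq => le_natDegree_of_mem_minimalPrimes hq (hd.symm.trans he)

/-! ### Linearity of the degree, and effective cycles under cuts -/

omit [Finite σ] in
theorem degree_sum {ι : Type*} (s : Finset ι) (Z : ι → Cycle (MvPolynomial σ K)) :
    degree (∑ i ∈ s, Z i) = ∑ i ∈ s, degree (Z i) := by
  classical
  simp only [degree]
  exact Finsupp.sum_finsetSum_index (by simp) (fun a b c => by push_cast; ring) |>.symm

omit [Finite σ] in
theorem degree_smul (a : ℤ) (Z : Cycle (MvPolynomial σ K)) : degree (a • Z) = a * degree Z := by
  rw [degree, degree, Finsupp.sum_smul_index (by simp), Finsupp.mul_sum]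
  refine Finsupp.sum_congr fun p _ => ?_
  push_cast
  ring

theorem schemeCycle_apply {R : Type*} [CommRing R] [IsNoetherianRing R] (I : Ideal R)
    (q : PrimeSpectrum R) : schemeCycle I q =
      {q : PrimeSpectrum R | q.asIdeal ∈ I.minimalPrimes}.indicator
        (fun q => (multAlong I q : ℤ)) q := by
  rw [schemeCycle, Finsupp.onFinset_apply]

theorem schemeCycle_nonneg {R : Type*} [CommRing R] [IsNoetherianRing R] (I : Ideal R) :
    0 ≤ schemeCycle I := by
  intro q
  rw [schemeCycle_apply]
  exact Set.indicator_nonneg (fun q _ => by positivity) q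

theorem cutPrime_nonneg {R : Type*} [CommRing R] [IsNoetherianRing R] (p : PrimeSpectrum R)
    (f : R) : 0 ≤ cutPrime p f := by
  classical
  rw [cutPrime]
  split_ifs
  · exact Finsupp.single_nonneg.mpr zero_le_one
  · exact schemeCycle_nonneg _

theorem cut_nonneg {R : Type*} [CommRing R] [IsNoetherianRing R] {Z : Cycle R} (hZ : 0 ≤ Z)
    (f : R) : 0 ≤ cut Z f :=
  Finset.sum_nonneg fun p _ => smul_nonneg (hZ p) (cutPrime_nonneg p f)

theorem degree_cut_le {Z : Cycle (MvPolynomial σ K)} (hZ : 0 ≤ Z) {f : MvPolynomial σ K}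
    (hf : f.totalDegree ≤ 1) : degree (cut Z f) ≤ degree Z := by
  rw [cut, Finsupp.sum, degree_sum]
  refine Finset.sum_le_sum fun p _ => ?_
  rw [degree_smul]
  exact mul_le_mul_of_nonneg_left (degree_cutPrime_le p hf) (by exact_mod_cast hZ p)

theorem degree_cutList_le {L : List (MvPolynomial σ K)} (hL : ∀ f ∈ L, f.totalDegree ≤ 1) :
    ∀ {Z : Cycle (MvPolynomial σ K)}, 0 ≤ Z → degree (cutList Z L) ≤ degree Z := by
  induction L with
  | nil => exact fun _ => le_rfl
  | cons f L ih =>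
    intro Z hZ
    rw [List.forall_mem_cons] at hL
    exact (ih hL.2 (cut_nonneg hZ f)).trans (degree_cut_le hZ hL.1)

end Cut

/-! ### Supports of successive intersections -/

section Support

variable {R : Type*} [CommRing R] [IsNoetherianRing R]

theorem mem_support_cutPrime {p q : PrimeSpectrum R} {f : R} (h : q ∈ (cutPrime p f).support) :
    p.asIdeal ≤ q.asIdeal ∧ f ∈ q.asIdeal := by
  classical
  rw [cutPrime] at h
  split_ifs at h with hf
  · rw [Finset.mem_singleton.mp (Finsupp.support_single_subset h)]
    exact ⟨le_rfl, hf⟩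
  · have hq : q.asIdeal ∈ (p.asIdeal ⊔ Ideal.span {f}).minimalPrimes := by
      by_contra hq
      rw [Finsupp.mem_support_iff] at h
      rw [schemeCycle_apply] at h
      exact h (Set.indicator_of_notMem (s := {q : PrimeSpectrum R |
        q.asIdeal ∈ (p.asIdeal ⊔ Ideal.span {f}).minimalPrimes}) hq _)
    exact ⟨le_sup_left.trans hq.1.2,
      hq.1.2 (Ideal.mem_sup_right (Ideal.mem_span_singleton_self f))⟩

theorem mem_support_cut {Z : Cycle R} {q : PrimeSpectrum R} {f : R} (h : q ∈ (cut Z f).support) :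
    f ∈ q.asIdeal ∧ ∃ p ∈ Z.support, p.asIdeal ≤ q.asIdeal := by
  classical
  rw [cut] at h
  obtain ⟨p, hp, hq⟩ := Finset.mem_biUnion.mp (Finsupp.support_sum h)
  have := mem_support_cutPrime (Finsupp.support_smul hq)
  exact ⟨this.2, p, hp, this.1⟩

/-- Cutting only passes to larger primes, so an equation satisfied on a component persists through
all later cuts. -/
theorem mem_support_cutList (L : List R) : ∀ {Z : Cycle R} {q : PrimeSpectrum R},
    q ∈ (cutList Z L).support →
      (∃ p ∈ Z.support, p.asIdeal ≤ q.asIdeal) ∧ ∀ f ∈ L, f ∈ q.asIdeal := by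
  induction L with
  | nil => exact fun h => ⟨⟨_, h, le_rfl⟩, by simp⟩
  | cons f L ih =>
    intro Z q h
    obtain ⟨⟨p, hp, hpq⟩, hL⟩ := ih h
    obtain ⟨hf, p', hp', hpp'⟩ := mem_support_cut hp
    exact ⟨⟨p', hp', hpp'.trans hpq⟩, List.forall_mem_cons.mpr ⟨hpq hf, hL⟩⟩

end Support

end VogelCycle
end

noncomputable section
namespace VogelCycle

open Polynomial Filter

/-! ### Hilbert functions of products -/

section ProductBound

variable {K : Type*} [Field K]

/-- Complements of each step in the next one stand in for the associated graded space; their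
dimensions are the first differences of the dimensions of the filtration. -/
theorem exists_graded_complements {A : Type*} [AddCommGroup A] [Module K A]
    (F : ℕ → Submodule K A) (hF : Monotone F) [∀ t, FiniteDimensional K (F t)] :
    ∃ C : ℕ → Submodule K A, (∀ k, FiniteDimensional K (C k)) ∧
      (∀ t, F t ≤ ∑ k ∈ Finset.range (t + 1), C k) ∧
      ∀ t, Module.finrank K (F t) = ∑ k ∈ Finset.range (t + 1), Module.finrank K (C k) := by
  choose D hD using fun t => (F t).exists_isCompl
  obtain ⟨C, hC0, hCs⟩ : ∃ C : ℕ → Submodule K A, C 0 = F 0 ∧ ∀ k, C (k + 1) = D k ⊓ F (k + 1) :=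
    ⟨fun k => Nat.casesOn (motive := fun _ => Submodule K A) k (F 0) fun k => D k ⊓ F (k + 1),
      rfl, fun _ => rfl⟩
  have hC (k : ℕ) : FiniteDimensional K (C k) := by
    cases k with
    | zero => rw [hC0]; infer_instance
    | succ k =>
      rw [hCs]
      exact Submodule.finiteDimensional_of_le (inf_le_right : D k ⊓ F (k + 1) ≤ F (k + 1))
  have hsup : ∀ k, F k ⊔ C (k + 1) = F (k + 1) := by
    intro k
    rw [hCs, ← sup_inf_assoc_of_le _ (hF (Nat.le_succ k)), (hD k).sup_eq_top, top_inf_eq]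
  have hinf : ∀ k, F k ⊓ C (k + 1) = ⊥ := by
    intro k
    rw [hCs, ← inf_assoc, (hD k).inf_eq_bot, bot_inf_eq]
  refine ⟨C, hC, fun t => ?_, fun t => ?_⟩
  · induction t with
    | zero => simp [hC0]
    | succ t ih =>
      rw [Finset.sum_range_succ, ← hsup t, Submodule.add_eq_sup]
      exact sup_le_sup_right ih _
  · induction t with
    | zero => rw [zero_add, Finset.sum_range_one, hC0]
    | succ t ih =>
      rw [Finset.sum_range_succ, ← ih, ← hsup t,
        ← Submodule.finrank_sup_add_finrank_inf_eq (F t) (C (t + 1)), hinf, finrank_bot, add_zero]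

theorem finrank_sum_le {A ι : Type*} [AddCommGroup A] [Module K A] (s : Finset ι)
    (C : ι → Submodule K A) (hC : ∀ i, FiniteDimensional K (C i)) :
    FiniteDimensional K ↥(∑ i ∈ s, C i) ∧
      Module.finrank K ↥(∑ i ∈ s, C i) ≤ ∑ i ∈ s, Module.finrank K (C i) := by
  classical
  induction s using Finset.induction_on with
  | empty =>
    rw [Finset.sum_empty, Submodule.zero_eq_bot]
    exact ⟨inferInstance, by simp⟩
  | insert i s hi ih =>
    have := ih.1
    rw [Finset.sum_insert hi, Finset.sum_insert hi, Submodule.add_eq_sup]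
    exact ⟨inferInstance, (Submodule.finrank_add_le_finrank_add_finrank _ _).trans
      (Nat.add_le_add_left ih.2 _)⟩

theorem finrank_prod_le {A ι : Type*} [CommRing A] [Algebra K A] (s : Finset ι)
    (C : ι → Submodule K A) (hC : ∀ i, FiniteDimensional K (C i)) :
    FiniteDimensional K ↥(∏ i ∈ s, C i) ∧
      Module.finrank K ↥(∏ i ∈ s, C i) ≤ ∏ i ∈ s, Module.finrank K (C i) := by
  classical
  induction s using Finset.induction_on with
  | empty =>
    rw [Finset.prod_empty, Finset.prod_empty, Submodule.one_eq_span]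
    exact ⟨inferInstance, (finrank_span_le_card {(1 : A)}).trans (by simp)⟩
  | insert i s hi ih =>
    have := ih.1
    rw [Finset.prod_insert hi, Finset.prod_insert hi]
    exact ⟨Module.Finite.iff_fg.mpr
      ((Module.Finite.iff_fg.mp (hC i)).mul (Module.Finite.iff_fg.mp ih.1)),
      (finrank_submodule_mul_le _ _).trans (Nat.mul_le_mul_left _ ih.2)⟩

theorem le_sum_submodule {A ι : Type*} [AddCommGroup A] [Module K A] {s : Finset ι}
    (C : ι → Submodule K A) {i : ι} (hi : i ∈ s) : C i ≤ ∑ i ∈ s, C i := by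
  classical
  rw [← Finset.add_sum_erase s C hi, Submodule.add_eq_sup]
  exact le_sup_left

theorem sum_submodule_le {A ι : Type*} [AddCommGroup A] [Module K A] {s : Finset ι}
    {C : ι → Submodule K A} {M : Submodule K A} (h : ∀ i ∈ s, C i ≤ M) : ∑ i ∈ s, C i ≤ M := by
  classical
  induction s using Finset.induction_on with
  | empty => simp
  | insert i s hi ih =>
    rw [Finset.sum_insert hi, Submodule.add_eq_sup]
    exact sup_le (h i (Finset.mem_insert_self i s))
      (ih fun j hj => h j (Finset.mem_insert_of_mem hj))

theorem prod_mem_prod_submodule {A ι : Type*} [CommRing A] [Algebra K A] (s : Finset ι)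
    {C : ι → Submodule K A} {f : ι → A} (h : ∀ i ∈ s, f i ∈ C i) :
    ∏ i ∈ s, f i ∈ ∏ i ∈ s, C i := by
  classical
  induction s using Finset.induction_on with
  | empty =>
    rw [Finset.prod_empty, Finset.prod_empty]
    exact Submodule.one_le.mp le_rfl
  | insert i s hi ih =>
    rw [Finset.prod_insert hi, Finset.prod_insert hi]
    exact Submodule.mul_mem_mul (h i (Finset.mem_insert_self i s))
      (ih fun j hj => h j (Finset.mem_insert_of_mem hj))

open MvPolynomial

variable {n s : ℕ}

/-- The ideal of the product of the affine schemes defined by the ideals `p i`. -/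
def prodIdeal (p : Fin s → Ideal (MvPolynomial (Fin n) K)) :
    Ideal (MvPolynomial (Fin s × Fin n) K) :=
  ⨆ i, (p i).map (projPullback K n i).toRingHom

/-- The pullback of functions along the projection from a product to a factor. -/
def factorPullback (p : Fin s → Ideal (MvPolynomial (Fin n) K)) (i : Fin s) :
    (MvPolynomial (Fin n) K ⧸ p i) →ₐ[K] MvPolynomial (Fin s × Fin n) K ⧸ prodIdeal p :=
  Ideal.Quotient.liftₐ (p i) ((Ideal.Quotient.mkₐ K (prodIdeal p)).comp (projPullback K n i))
    fun a ha => by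
      rw [AlgHom.comp_apply, Ideal.Quotient.mkₐ_eq_mk, Ideal.Quotient.eq_zero_iff_mem]
      exact (le_iSup (fun i => (p i).map (projPullback K n i).toRingHom) i)
        (Ideal.mem_map_of_mem (projPullback K n i).toRingHom ha)

theorem monomial_eq_prod_projPullback (b : Fin s × Fin n →₀ ℕ) :
    MvPolynomial.monomial b (1 : K) = ∏ i, projPullback K n i (MvPolynomial.monomial
      (Finsupp.equivFunOnFinite.symm fun j => b (i, j)) 1) := by
  have h1 : ∀ {τ : Type} [Fintype τ] (a : τ →₀ ℕ), MvPolynomial.monomial a (1 : K) =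
      ∏ j, MvPolynomial.X j ^ a j := by
    intro τ _ a
    rw [MvPolynomial.monomial_eq, MvPolynomial.C_1, one_mul, Finsupp.prod_fintype _ _ (by simp)]
  rw [h1, Fintype.prod_prod_type]
  refine Finset.prod_congr rfl fun i _ => ?_
  rw [h1, map_prod]
  refine Finset.prod_congr rfl fun j _ => ?_
  rw [map_pow, projPullback, rename_X]
  rfl

/-- A monomial on the product is a product of monomials on the factors whose degrees add up to its
degree. Each lies in a sum of pieces `C i k` with `k` at most its degree; expanding the product
sorts the terms by total index. -/
theorem degreeFiltration_prodIdeal_le (p : Fin s → Ideal (MvPolynomial (Fin n) K))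
    (C : ∀ i, ℕ → Submodule K (MvPolynomial (Fin n) K ⧸ p i))
    (hC : ∀ i t, degreeFiltration (p i) t ≤ ∑ k ∈ Finset.range (t + 1), C i k) (t : ℕ) :
    degreeFiltration (prodIdeal p) t ≤ ∑ k ∈ Finset.range (t + 1),
      ∑ l ∈ Finset.finsuppAntidiag Finset.univ k,
        ∏ i, (C i (l i)).map (factorPullback p i).toLinearMap := by
  rw [degreeFiltration, restrictTotalDegree_eq_span, Submodule.map_span, Submodule.span_le]
  rintro _ ⟨_, ⟨b, hb, rfl⟩, rfl⟩
  let b' : Fin s → (Fin n →₀ ℕ) := fun i => Finsupp.equivFunOnFinite.symm fun j => b (i, j)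
  have hdeg : ∑ i, (b' i).degree ≤ t := by
    refine le_trans (Eq.le ?_) hb
    rw [Finsupp.degree_eq_sum, Fintype.sum_prod_type]
    refine Finset.sum_congr rfl fun i _ => ?_
    rw [Finsupp.degree_eq_sum]
    rfl
  have h1 : ∀ i, factorPullback p i (Ideal.Quotient.mk (p i) (MvPolynomial.monomial (b' i) 1)) ∈
      ∑ k ∈ Finset.range ((b' i).degree + 1), (C i k).map (factorPullback p i).toLinearMap := by
    intro i
    have h2 := hC i (b' i).degree (mk_mem_degreeFiltration (p i)
      (totalDegree_monomial_le (b' i) (1 : K)))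
    have h3 : ∑ k ∈ Finset.range ((b' i).degree + 1), C i k ≤
        (∑ k ∈ Finset.range ((b' i).degree + 1),
          (C i k).map (factorPullback p i).toLinearMap).comap
            (factorPullback p i).toLinearMap :=
      sum_submodule_le fun k hk => Submodule.map_le_iff_le_comap.mp
        (le_sum_submodule (fun k => (C i k).map (factorPullback p i).toLinearMap) hk)
    exact h3 h2
  have h4 : Ideal.Quotient.mk (prodIdeal p) (MvPolynomial.monomial b 1) ∈
      ∏ i, ∑ k ∈ Finset.range ((b' i).degree + 1),
        (C i k).map (factorPullback p i).toLinearMap := by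
    rw [monomial_eq_prod_projPullback, map_prod]
    exact prod_mem_prod_submodule Finset.univ fun i _ => h1 i
  rw [Finset.prod_univ_sum (fun i => Finset.range ((b' i).degree + 1))
    fun i k => (C i k).map (factorPullback p i).toLinearMap] at h4
  refine sum_submodule_le (fun a ha => ?_) h4
  have ha' : ∑ i, a i ≤ t := by
    refine (Finset.sum_le_sum fun i _ => ?_).trans hdeg
    have := Fintype.mem_piFinset.mp ha i
    rw [Finset.mem_range] at this
    omega
  refine le_trans ?_ (le_sum_submodule _ (Finset.mem_range.mpr (Nat.lt_succ_iff.mpr ha')))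
  exact le_sum_submodule (fun l : Fin s →₀ ℕ =>
    ∏ i, (C i (l i)).map (factorPullback p i).toLinearMap)
    (i := Finsupp.equivFunOnFinite.symm a) (by simp [Finset.mem_finsuppAntidiag])

/-- The functions `h i` are the first differences of the Hilbert functions of the factors. Only an
upper bound is claimed, so no independence of the products of pieces is needed. -/
theorem exists_affineRank_prodIdeal_le (p : Fin s → Ideal (MvPolynomial (Fin n) K)) :
    ∃ h : Fin s → ℕ → ℕ,
      (∀ i t, affineRank (p i) t = ∑ k ∈ Finset.range (t + 1), h i k) ∧
      ∀ t, affineRank (prodIdeal p) t ≤ ∑ k ∈ Finset.range (t + 1),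
        ∑ l ∈ Finset.finsuppAntidiag Finset.univ k, ∏ i, h i (l i) := by
  choose C hCfin hC hCrank using fun i =>
    exists_graded_complements (degreeFiltration (p i)) (degreeFiltration_mono (p i))
  refine ⟨fun i k => Module.finrank K (C i k), hCrank, fun t => ?_⟩
  have hfin : ∀ i k, FiniteDimensional K ((C i k).map (factorPullback p i).toLinearMap) :=
    fun i k => inferInstance
  have hprod := fun l : Fin s →₀ ℕ => finrank_prod_le Finset.univ
    (fun i => (C i (l i)).map (factorPullback p i).toLinearMap) fun i => hfin i _
  have hsum := fun k => finrank_sum_le (Finset.finsuppAntidiag (Finset.univ : Finset (Fin s)) k)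
    (fun l => ∏ i, (C i (l i)).map (factorPullback p i).toLinearMap) fun l => (hprod l).1
  have htot := finrank_sum_le (Finset.range (t + 1)) _ fun k => (hsum k).1
  have := htot.1
  refine (Submodule.finrank_mono (degreeFiltration_prodIdeal_le p C hC t)).trans
    (htot.2.trans (Finset.sum_le_sum fun k _ => (hsum k).2.trans
      (Finset.sum_le_sum fun l _ => (hprod l).2.trans (Finset.prod_le_prod' fun i _ => ?_))))
  exact Submodule.finrank_map_le _ _

theorem one_sub_X_mul_mk_of_sum {f c : ℕ → ℚ}
    (h : ∀ t, f t = ∑ k ∈ Finset.range (t + 1), c k) :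
    (1 - PowerSeries.X) * PowerSeries.mk f = PowerSeries.mk c := by
  ext k
  cases k with
  | zero => simp [sub_mul, h]
  | succ k =>
    rw [sub_mul, one_mul, map_sub, PowerSeries.coeff_succ_X_mul, PowerSeries.coeff_mk,
      PowerSeries.coeff_mk, PowerSeries.coeff_mk, h (k + 1), Finset.sum_range_succ, ← h k]
    ring

/-- The Hilbert function of a product is bounded by a polynomial with leading coefficient given
by the product of the degrees. -/
theorem exists_polynomial_prodIdeal (p : Fin s → PrimeSpectrum (MvPolynomial (Fin n) K)) {e : ℕ}
    (he : ∑ i, (hilbertPolynomial (closureIdeal (p i))).natDegree = e) :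
    ∃ U : ℚ[X], U.natDegree ≤ e ∧
      (∀ᶠ t : ℕ in atTop, (affineRank (prodIdeal fun i => (p i).asIdeal) t : ℚ) ≤
        U.eval (t : ℚ)) ∧
      (e.factorial : ℚ) * U.coeff e = ∏ i, projDegree (closureIdeal (p i)) := by
  choose N hN hN1 using fun i => exists_generating_polynomial (p i)
  obtain ⟨h, hh, hle⟩ := exists_affineRank_prodIdeal_le fun i => (p i).asIdeal
  let c : ℕ → ℚ := fun k =>
    PowerSeries.coeff k (∏ i, PowerSeries.mk fun t => (h i t : ℚ))
  let u : ℕ → ℚ := fun t => ∑ k ∈ Finset.range (t + 1), c k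
  -- The differences of factor `i` have generating function $N_i/(1-X)^{d_i}$; the convolution
  -- multiplies these, and the partial sums add one more factor $1-X$ to the denominator.
  have hu : ((∏ i, N i : ℚ[X]) : PowerSeries ℚ) =
      (1 - PowerSeries.X) ^ (e + 1) * PowerSeries.mk u := by
    rw [pow_succ, mul_assoc _ (1 - PowerSeries.X) (PowerSeries.mk u),
      one_sub_X_mul_mk_of_sum (f := u) (c := c) fun _ => rfl]
    have h1 : PowerSeries.mk c = ∏ i, PowerSeries.mk fun t => (h i t : ℚ) := by
      ext k; simp [c]
    rw [h1, ← he, ← Finset.prod_pow_eq_pow_sum, ← Finset.prod_mul_distrib]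
    rw [← Polynomial.coeToPowerSeries.ringHom_apply, map_prod]
    refine Finset.prod_congr rfl fun i _ => ?_
    rw [Polynomial.coeToPowerSeries.ringHom_apply, hN, pow_succ, mul_assoc,
      one_sub_X_mul_mk_of_sum (c := fun t => (h i t : ℚ)) fun t => by exact_mod_cast hh i t]
  refine ⟨hilbertPoly (∏ i, N i) (e + 1), natDegree_hilbertPoly_succ_le _ _, ?_, ?_⟩
  · filter_upwards [eventually_eval_hilbertPoly hu] with t ht
    rw [ht]
    have h2 : u t = ((∑ k ∈ Finset.range (t + 1),
        ∑ l ∈ Finset.finsuppAntidiag Finset.univ k, ∏ i, h i (l i) : ℕ) : ℚ) := by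
      simp only [u, c, PowerSeries.coeff_prod, PowerSeries.coeff_mk]
      push_cast
      rfl
    rw [h2]
    exact_mod_cast hle t
  · rw [coeff_hilbertPoly_succ, Polynomial.eval_prod]
    exact Finset.prod_congr rfl fun i _ => hN1 i

end ProductBound

end VogelCycle
end

noncomputable section
namespace VogelCycle

open scoped TensorProduct

/-! ### Components of products -/

section FreeEmbedding

variable {K : Type*} [Field K]

/-- The algebra `B` embeds into a free module over `S`, linearly over `S`. -/
def EmbedsInFree {S B : Type*} [CommRing S] [Algebra K S] [CommRing B] [Algebra K B]
    (f : S →ₐ[K] B) : Prop :=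
  ∃ (ι : Type) (E : B →ₗ[K] ι →₀ S), Function.Injective E ∧ ∀ g b, E (f g * b) = g • E b

section

variable {S S' B B' : Type*} [CommRing S] [Algebra K S] [CommRing B] [Algebra K B]
  [CommRing S'] [Algebra K S'] [CommRing B'] [Algebra K B']

theorem EmbedsInFree.comp_equiv {f : S →ₐ[K] B} (hf : EmbedsInFree f) (e : S' ≃ₐ[K] S)
    (e' : B ≃ₐ[K] B') : EmbedsInFree ((e'.toAlgHom.comp f).comp e.toAlgHom) := by
  obtain ⟨ι, E, hE, hlin⟩ := hf
  refine ⟨ι, (Finsupp.mapRange.linearMap e.symm.toLinearMap) ∘ₗ E ∘ₗ e'.symm.toLinearMap, ?_, ?_⟩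
  · rw [LinearMap.coe_comp, LinearMap.coe_comp]
    refine Function.Injective.comp ?_ (hE.comp e'.symm.injective)
    exact Finsupp.mapRange_injective _ (map_zero e.symm) e.symm.injective
  · intro g b
    simp only [AlgHom.comp_apply, LinearMap.comp_apply, AlgEquiv.toLinearMap_apply]
    have h1 : e'.symm (e'.toAlgHom (f (e.toAlgHom g)) * b) = f (e g) * e'.symm b := by
      rw [map_mul]
      congr 1
      exact e'.symm_apply_apply _
    rw [h1, hlin]
    ext i
    simp

theorem embedsInFree_of_equiv (e : S ≃ₐ[K] B) : EmbedsInFree e.toAlgHom := by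
  refine ⟨Unit, Finsupp.lsingle () ∘ₗ e.symm.toLinearMap, ?_, ?_⟩
  · exact (Finsupp.single_injective ()).comp e.symm.injective
  · intro g b
    simp

/-- Over a field the tensor product of two injective maps is injective, and the tensor product of
free modules over $S$ and $S'$ is free over $S\otimes_K S'$. This stability is what the notion
serves: no irreducibility or reducedness of the product is required. -/
theorem EmbedsInFree.tensor {f : S →ₐ[K] B} (hf : EmbedsInFree f) {f' : S' →ₐ[K] B'}
    (hf' : EmbedsInFree f') : EmbedsInFree (Algebra.TensorProduct.map f f') := by
  obtain ⟨ι, E, hE, hlin⟩ := hf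
  obtain ⟨κ, E', hE', hlin'⟩ := hf'
  let T := finsuppTensorFinsupp K K S S' ι κ
  refine ⟨ι × κ, T.toLinearMap ∘ₗ TensorProduct.map E E', ?_, ?_⟩
  · exact T.injective.comp (TensorProduct.map_injective_of_flat_flat E E' hE hE')
  · intro g b
    induction g using TensorProduct.induction_on with
    | zero => simp
    | add g g' h h' => rw [map_add, add_mul, map_add, h, h', add_smul]
    | tmul g g' =>
      induction b using TensorProduct.induction_on with
      | zero => simp
      | add b b' h h' => rw [mul_add, map_add, h, h', map_add, smul_add]
      | tmul b b' =>
        rw [Algebra.TensorProduct.map_tmul, Algebra.TensorProduct.tmul_mul_tmul]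
        simp only [LinearMap.comp_apply, TensorProduct.map_tmul, hlin, hlin']
        ext ⟨i, k⟩
        simp [T, Algebra.TensorProduct.tmul_mul_tmul]

end

/-- Coordinates of $\operatorname{Frac}A$ over $\operatorname{Frac}S$ embed $A$ into a
finite-dimensional space; a common denominator `c` of the coordinates of finitely many generators
moves the image into $S^r$. -/
theorem exists_linearMap_injective_of_finite (S A : Type*) [CommRing S] [IsDomain S] [CommRing A]
    [IsDomain A] [Algebra S A] [FaithfulSMul S A] [Module.Finite S A] :
    ∃ (r : ℕ) (E : A →ₗ[S] Fin r → S), Function.Injective E := by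
  let _ : Algebra (FractionRing S) (FractionRing A) := FractionRing.liftAlgebra S (FractionRing A)
  have hfd : FiniteDimensional (FractionRing S) (FractionRing A) :=
    .of_isLocalization S A (nonZeroDivisors S)
  let b := Module.finBasis (FractionRing S) (FractionRing A)
  let r := Module.finrank (FractionRing S) (FractionRing A)
  let co : A →ₗ[S] Fin r → FractionRing S :=
    (b.equivFun.toLinearMap.restrictScalars S) ∘ₗ (IsScalarTower.toAlgHom S A _).toLinearMap
  have hco : Function.Injective co :=
    b.equivFun.injective.comp (IsFractionRing.injective A (FractionRing A))
  obtain ⟨G, hG⟩ := (inferInstance : Module.Finite S A).fg_top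
  obtain ⟨c, hc⟩ := IsLocalization.exist_integer_multiples_of_finite (nonZeroDivisors S)
    (fun x : G × Fin r => co x.1 x.2)
  let incl : (Fin r → S) →ₗ[S] Fin r → FractionRing S :=
    LinearMap.pi fun k => Algebra.linearMap S (FractionRing S) ∘ₗ LinearMap.proj k
  have hincl : Function.Injective incl := by
    intro x y hxy
    funext k
    exact IsFractionRing.injective S (FractionRing S) (congrFun hxy k)
  have hrange : ∀ a, ((c : S) • co) a ∈ LinearMap.range incl := by
    intro a
    have ha : a ∈ Submodule.span S (G : Set A) := hG ▸ Submodule.mem_top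
    have hle : Submodule.span S (G : Set A) ≤ (LinearMap.range incl).comap ((c : S) • co) := by
      refine Submodule.span_le.mpr fun g hg => ?_
      choose y hy using fun k => hc (⟨g, hg⟩, k)
      exact ⟨y, funext fun k => hy k⟩
    exact hle ha
  have hinj : Function.Injective ((c : S) • co) := by
    intro x y hxy
    refine hco ?_
    funext k
    have h1 := congrFun hxy k
    simp only [LinearMap.smul_apply, Pi.smul_apply, Algebra.smul_def] at h1
    exact mul_left_cancel₀ (IsLocalization.map_units (FractionRing S) c).ne_zero h1
  let e := LinearEquiv.ofInjective incl hincl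
  refine ⟨r, e.symm.toLinearMap ∘ₗ ((c : S) • co).codRestrict (LinearMap.range incl) hrange, ?_⟩
  refine e.symm.injective.comp fun x y hxy => hinj ?_
  exact congrArg Subtype.val hxy

theorem embedsInFree_of_finite {S A : Type*} [CommRing S] [IsDomain S] [Algebra K S] [CommRing A]
    [IsDomain A] [Algebra K A] (f : S →ₐ[K] A) (hf : Function.Injective f) (hfin : f.Finite) :
    EmbedsInFree f := by
  let _ : Algebra S A := f.toRingHom.toAlgebra
  have : FaithfulSMul S A := (faithfulSMul_iff_algebraMap_injective _ _).mpr hf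
  have : Module.Finite S A := hfin
  have : IsScalarTower K S A := IsScalarTower.of_algebraMap_eq fun x => (f.commutes x).symm
  obtain ⟨r, E, hE⟩ := exists_linearMap_injective_of_finite S A
  let e := (Finsupp.linearEquivFunOnFinite S S (Fin r)).symm
  refine ⟨Fin r, (e.toLinearMap ∘ₗ E).restrictScalars K, e.injective.comp hE, fun g b => ?_⟩
  exact map_smul (e.toLinearMap ∘ₗ E) g b

end FreeEmbedding

section ProductComponents

open MvPolynomial

variable {K : Type*} [Field K] {n s : ℕ}

theorem mk_projPullback_eq_zero (p : Fin s → Ideal (MvPolynomial (Fin n) K)) (i : Fin s)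
    {a : MvPolynomial (Fin n) K} (ha : a ∈ p i) :
    Ideal.Quotient.mk (prodIdeal p) (projPullback K n i a) = 0 :=
  Ideal.Quotient.eq_zero_iff_mem.mpr
    ((le_iSup (fun i => (p i).map (projPullback K n i).toRingHom) i)
      (Ideal.mem_map_of_mem (projPullback K n i).toRingHom ha))

theorem prodIdeal_le_ker {A : Type*} [CommRing A] [Algebra K A]
    (p : Fin s → Ideal (MvPolynomial (Fin n) K)) (F : MvPolynomial (Fin s × Fin n) K →ₐ[K] A)
    (h : ∀ i, ∀ a ∈ p i, F (projPullback K n i a) = 0) {a : MvPolynomial (Fin s × Fin n) K}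
    (ha : a ∈ prodIdeal p) : F a = 0 := by
  have hle : prodIdeal p ≤ RingHom.ker F.toRingHom :=
    iSup_le fun i => Ideal.map_le_iff_le_comap.mpr fun a ha => h i a ha
  exact hle ha

/-- The pullback of functions along the projection of a product to the product of all factors
but the first one. -/
def tailPullback (p : Fin (s + 1) → Ideal (MvPolynomial (Fin n) K)) :
    (MvPolynomial (Fin s × Fin n) K ⧸ prodIdeal fun i => p i.succ) →ₐ[K]
      MvPolynomial (Fin (s + 1) × Fin n) K ⧸ prodIdeal p :=
  Ideal.Quotient.liftₐ _ ((Ideal.Quotient.mkₐ K (prodIdeal p)).comp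
    (rename (Prod.map Fin.succ id))) fun _ ha => prodIdeal_le_ker _ _ (fun i a ha => by
      rw [AlgHom.comp_apply, projPullback, rename_rename]
      exact mk_projPullback_eq_zero p i.succ ha) ha

/-- The coordinate functions of a product, as elements of the tensor product of the coordinate
rings of the first factor and of the product of the other ones. -/
def splitCoord (p : Fin (s + 1) → Ideal (MvPolynomial (Fin n) K)) (a : Fin (s + 1) × Fin n) :
    (MvPolynomial (Fin n) K ⧸ p 0) ⊗[K]
      (MvPolynomial (Fin s × Fin n) K ⧸ prodIdeal fun i => p i.succ) :=
  Fin.cases (Ideal.Quotient.mk (p 0) (X a.2) ⊗ₜ 1)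
    (fun i => 1 ⊗ₜ Ideal.Quotient.mk (prodIdeal fun i => p i.succ) (X (i, a.2))) a.1

theorem aeval_splitCoord_projPullback_zero (p : Fin (s + 1) → Ideal (MvPolynomial (Fin n) K))
    (a : MvPolynomial (Fin n) K) : aeval (splitCoord p) (projPullback K n 0 a) =
      Ideal.Quotient.mk (p 0) a ⊗ₜ[K] 1 := by
  have h : (aeval (splitCoord p)).comp (projPullback K n 0) =
      Algebra.TensorProduct.includeLeft.comp (Ideal.Quotient.mkₐ K (p 0)) := by
    ext j
    simp [projPullback, splitCoord]
  exact DFunLike.congr_fun h a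

theorem aeval_splitCoord_projPullback_succ (p : Fin (s + 1) → Ideal (MvPolynomial (Fin n) K))
    (i : Fin s) (a : MvPolynomial (Fin n) K) :
    aeval (splitCoord p) (projPullback K n i.succ a) =
      1 ⊗ₜ[K] Ideal.Quotient.mk (prodIdeal fun i => p i.succ) (projPullback K n i a) := by
  have h : (aeval (splitCoord p)).comp (projPullback K n i.succ) =
      Algebra.TensorProduct.includeRight.comp ((Ideal.Quotient.mkₐ K
        (prodIdeal fun i => p i.succ)).comp (projPullback K n i)) := by
    ext j
    simp [projPullback, splitCoord]
  exact DFunLike.congr_fun h a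

theorem aeval_splitCoord_eq_zero (p : Fin (s + 1) → Ideal (MvPolynomial (Fin n) K))
    (a : MvPolynomial (Fin (s + 1) × Fin n) K) (ha : a ∈ prodIdeal p) :
    aeval (splitCoord p) a = 0 := by
  refine prodIdeal_le_ker p (aeval (splitCoord p)) (fun i a ha => ?_) ha
  induction i using Fin.cases with
  | zero =>
    exact (aeval_splitCoord_projPullback_zero p a).trans
      ((congrArg (· ⊗ₜ[K] 1) (Ideal.Quotient.eq_zero_iff_mem.mpr ha)).trans
        (TensorProduct.zero_tmul _ _))
  | succ i =>
    exact (aeval_splitCoord_projPullback_succ p i a).trans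
      ((congrArg (1 ⊗ₜ[K] ·) (mk_projPullback_eq_zero (fun i => p (Fin.succ i)) i ha)).trans
        (TensorProduct.tmul_zero _ _))

/-- The functions on a product as elements of the tensor product of the coordinate rings of the
first factor and of the product of the other ones. -/
def splitHom (p : Fin (s + 1) → Ideal (MvPolynomial (Fin n) K)) :
    (MvPolynomial (Fin (s + 1) × Fin n) K ⧸ prodIdeal p) →ₐ[K]
      (MvPolynomial (Fin n) K ⧸ p 0) ⊗[K]
        (MvPolynomial (Fin s × Fin n) K ⧸ prodIdeal fun i => p i.succ) :=
  Ideal.Quotient.liftₐ (prodIdeal p) (aeval (splitCoord p)) (aeval_splitCoord_eq_zero p)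

theorem splitHom_mk_X (p : Fin (s + 1) → Ideal (MvPolynomial (Fin n) K))
    (a : Fin (s + 1) × Fin n) :
    splitHom p (Ideal.Quotient.mk _ (X a)) = splitCoord p a :=
  aeval_X (splitCoord p) a

theorem factorPullback_mk_X (p : Fin s → Ideal (MvPolynomial (Fin n) K)) (i : Fin s) (j : Fin n) :
    factorPullback p i (Ideal.Quotient.mk _ (X j)) = Ideal.Quotient.mk _ (X (i, j)) :=
  congrArg (Ideal.Quotient.mk _) (rename_X (fun j => (i, j)) j)

theorem tailPullback_mk_X (p : Fin (s + 1) → Ideal (MvPolynomial (Fin n) K)) (i : Fin s)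
    (j : Fin n) :
    tailPullback p (Ideal.Quotient.mk _ (X (i, j))) = Ideal.Quotient.mk _ (X (i.succ, j)) :=
  congrArg (Ideal.Quotient.mk _) (rename_X (Prod.map Fin.succ id) (i, j))

/-- A product of `s + 1` affine schemes is the product of the first one and the product of the
other ones. -/
def prodIdealSuccEquiv (p : Fin (s + 1) → Ideal (MvPolynomial (Fin n) K)) :
    (MvPolynomial (Fin n) K ⧸ p 0) ⊗[K]
        (MvPolynomial (Fin s × Fin n) K ⧸ prodIdeal fun i => p i.succ) ≃ₐ[K]
      MvPolynomial (Fin (s + 1) × Fin n) K ⧸ prodIdeal p :=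
  AlgEquiv.ofAlgHom (Algebra.TensorProduct.productMap (factorPullback p 0) (tailPullback p))
    (splitHom p)
    (by
      refine Ideal.Quotient.algHom_ext _ (MvPolynomial.algHom_ext fun a => ?_)
      obtain ⟨i, j⟩ := a
      change Algebra.TensorProduct.productMap (factorPullback p 0) (tailPullback p)
        (splitHom p (Ideal.Quotient.mk _ (X (i, j)))) = Ideal.Quotient.mk _ (X (i, j))
      rw [splitHom_mk_X]
      induction i using Fin.cases with
      | zero =>
        change Algebra.TensorProduct.productMap (factorPullback p 0) (tailPullback p)
          (Ideal.Quotient.mk (p 0) (X j) ⊗ₜ 1) = _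
        rw [Algebra.TensorProduct.productMap_apply_tmul, map_one, mul_one, factorPullback_mk_X]
      | succ i =>
        change Algebra.TensorProduct.productMap (factorPullback p 0) (tailPullback p)
          (1 ⊗ₜ Ideal.Quotient.mk _ (X (i, j))) = _
        rw [Algebra.TensorProduct.productMap_apply_tmul, map_one, one_mul, tailPullback_mk_X])
    (by
      refine Algebra.TensorProduct.ext ?_ ?_
      · refine Ideal.Quotient.algHom_ext _ (MvPolynomial.algHom_ext fun j => ?_)
        change splitHom p (Algebra.TensorProduct.productMap (factorPullback p 0) (tailPullback p)
          (Ideal.Quotient.mk (p 0) (X j) ⊗ₜ 1)) = Ideal.Quotient.mk (p 0) (X j) ⊗ₜ 1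
        rw [Algebra.TensorProduct.productMap_apply_tmul, map_one, mul_one, factorPullback_mk_X,
          splitHom_mk_X]
        rfl
      · refine Ideal.Quotient.algHom_ext _ (MvPolynomial.algHom_ext fun a => ?_)
        change splitHom p (Algebra.TensorProduct.productMap (factorPullback p 0) (tailPullback p)
          (1 ⊗ₜ Ideal.Quotient.mk _ (X a))) = 1 ⊗ₜ Ideal.Quotient.mk _ (X a)
        rw [Algebra.TensorProduct.productMap_apply_tmul, map_one, one_mul, tailPullback_mk_X,
          splitHom_mk_X]
        rfl)

/-- Induction on the number of factors, splitting off the first one; the empty product is a point.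
The number of variables is an existential `e` with an equation, which avoids casts between
polynomial rings. -/
theorem exists_embedsInFree_prodIdeal (p : Fin s → Ideal (MvPolynomial (Fin n) K)) (d : Fin s → ℕ)
    (φ : ∀ i, MvPolynomial (Fin (d i)) K →ₐ[K] MvPolynomial (Fin n) K ⧸ p i)
    (hφ : ∀ i, EmbedsInFree (φ i)) :
    ∃ (e : ℕ) (Φ : MvPolynomial (Fin e) K →ₐ[K] MvPolynomial (Fin s × Fin n) K ⧸ prodIdeal p),
      e = ∑ i, d i ∧ EmbedsInFree Φ := by
  induction s with
  | zero =>
    have hbot : prodIdeal p = ⊥ := by rw [prodIdeal, iSup_of_empty]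
    let e1 : MvPolynomial (Fin 0) K ≃ₐ[K] MvPolynomial (Fin 0 × Fin n) K ⧸ prodIdeal p :=
      ((isEmptyAlgEquiv K (Fin 0)).trans (isEmptyAlgEquiv K (Fin 0 × Fin n)).symm).trans
        ((AlgEquiv.quotientBot K _).symm.trans (Ideal.quotientEquivAlgOfEq K hbot.symm))
    exact ⟨0, e1.toAlgHom, by simp, embedsInFree_of_equiv e1⟩
  | succ s ih =>
    obtain ⟨e, Φ, he, hΦ⟩ := ih (fun i => p i.succ) (fun i => d i.succ) (fun i => φ i.succ)
      fun i => hφ i.succ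
    let e1 : MvPolynomial (Fin (d 0 + e)) K ≃ₐ[K]
        MvPolynomial (Fin (d 0)) K ⊗[K] MvPolynomial (Fin e) K :=
      (renameEquiv K finSumFinEquiv.symm).trans (tensorEquivSum K (Fin (d 0)) (Fin e) K).symm
    refine ⟨d 0 + e, _, ?_, ((hφ 0).tensor hΦ).comp_equiv e1 (prodIdealSuccEquiv p)⟩
    rw [Fin.sum_univ_succ, he]

/-- All components of a product of varieties have the sum of the dimensions as their dimension. -/
theorem le_natDegree_of_mem_minimalPrimes_prodIdeal
    (p : Fin s → PrimeSpectrum (MvPolynomial (Fin n) K))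
    {q : PrimeSpectrum (MvPolynomial (Fin s × Fin n) K)}
    (hq : q.asIdeal ∈ (prodIdeal fun i => (p i).asIdeal).minimalPrimes) :
    ∑ i, (hilbertPolynomial (closureIdeal (p i))).natDegree ≤
      (hilbertPolynomial (closureIdeal q)).natDegree := by
  choose φ hφ hfin using fun i => exists_finite_injective (p i)
  obtain ⟨e, Φ, he, ι, E, hE, hlin⟩ := exists_embedsInFree_prodIdeal (fun i => (p i).asIdeal) _ φ
    fun i => embedsInFree_of_finite (φ i) (hφ i) (hfin i)
  rw [← he]
  refine le_natDegree_of_injective ((Ideal.Quotient.factorₐ K hq.1.2).comp Φ)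
    ((injective_iff_map_eq_zero _).mpr fun g hg => ?_)
  obtain ⟨x, hx⟩ := Ideal.Quotient.mk_surjective (Φ g)
  have hxq : x ∈ q.asIdeal := by
    rw [← Ideal.Quotient.eq_zero_iff_mem, ← hg, AlgHom.comp_apply, ← hx]
    rfl
  -- Elements of a minimal prime are zero divisors modulo the ideal. Thus $\Phi(g)$ kills a nonzero
  -- class, and in the free module $g$ kills a nonzero vector, which forces $g=0$.
  obtain ⟨y, hy, hxy⟩ := Ideal.exists_mul_mem_of_mem_minimalPrimes hq hxq
  have h1 := hlin g (Ideal.Quotient.mk _ y)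
  rw [← hx, ← map_mul, Ideal.Quotient.eq_zero_iff_mem.mpr hxy, map_zero] at h1
  refine (smul_eq_zero.mp h1.symm).resolve_right fun h2 => hy ?_
  rw [← Ideal.Quotient.eq_zero_iff_mem]
  exact hE (h2.trans (map_zero E).symm)

theorem degree_prodPrimes_le (p : Fin s → PrimeSpectrum (MvPolynomial (Fin n) K)) :
    degree (prodPrimes p) ≤ ∏ i, projDegree (closureIdeal (p i)) := by
  obtain ⟨U, hU, hle, hcoeff⟩ := exists_polynomial_prodIdeal p rfl
  rw [← hcoeff]
  exact degree_schemeCycle_le _ _ U hU hle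
    fun q hq => le_natDegree_of_mem_minimalPrimes_prodIdeal p hq

theorem prodCycle_nonneg {X : Fin s → Cycle (MvPolynomial (Fin n) K)} (hX : ∀ j, 0 ≤ X j) :
    0 ≤ prodCycle X :=
  Finset.sum_nonneg fun p _ => smul_nonneg (Finset.prod_nonneg fun i _ => hX i (p i))
    (schemeCycle_nonneg _)

theorem degree_prodCycle_le {X : Fin s → Cycle (MvPolynomial (Fin n) K)} (hX : ∀ j, 0 ≤ X j) :
    degree (prodCycle X) ≤ ∏ j, degree (X j) := by
  rw [prodCycle, degree_sum]
  simp only [degree, Finsupp.sum]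
  rw [Finset.prod_univ_sum]
  refine Finset.sum_le_sum fun p _ => ?_
  have h := degree_smul (∏ i, X i (p i)) (prodPrimes p)
  rw [degree, Finsupp.sum] at h
  rw [h, Int.cast_prod, Finset.prod_mul_distrib]
  exact mul_le_mul_of_nonneg_left (degree_prodPrimes_le p)
    (Finset.prod_nonneg fun i _ => by exact_mod_cast hX i (p i))

end ProductComponents

end VogelCycle
end

noncomputable section
namespace VogelCycle

/-! ### Components in the diagonal -/

section Diagonal

open MvPolynomial

variable {K : Type*} [Field K] {n s : ℕ}

/-- On the diagonal a function agrees with the pullback, along any one projection, of its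
restriction to the diagonal. -/
theorem sub_mem_of_mem_diagonal {q : PrimeSpectrum (MvPolynomial (Fin s × Fin n) K)}
    (hq : q ∈ diagonal K n s) (r : Fin s) (f : MvPolynomial (Fin s × Fin n) K) :
    f - projPullback K n r (diagPullback K n s f) ∈ q.asIdeal := by
  obtain ⟨Q, rfl⟩ := hq
  change diagPullback K n s (f - projPullback K n r (diagPullback K n s f)) ∈ Q.asIdeal
  have h : ∀ g, diagPullback K n s (projPullback K n r g) = g := fun g => by
    rw [diagPullback, projPullback, rename_rename]
    exact rename_id_apply g
  rw [map_sub, h, sub_self]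
  exact Q.asIdeal.zero_mem

/-- Both the projection and the diagonal map pull back by renaming variables, which does not raise
total degree. The resulting isomorphism of coordinate rings therefore matches the degree
filtrations, not only the rings. -/
theorem affineRank_comap_projPullback {q : PrimeSpectrum (MvPolynomial (Fin s × Fin n) K)}
    (hq : q ∈ diagonal K n s) (r : Fin s) (t : ℕ) :
    affineRank (PrimeSpectrum.comap (projPullback K n r).toRingHom q).asIdeal t =
      affineRank q.asIdeal t := by
  let p := PrimeSpectrum.comap (projPullback K n r).toRingHom q
  let φ : (MvPolynomial (Fin n) K ⧸ p.asIdeal) →ₐ[K]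
      MvPolynomial (Fin s × Fin n) K ⧸ q.asIdeal :=
    Ideal.quotientMapₐ q.asIdeal (projPullback K n r) le_rfl
  have hφ : Function.Injective φ := Ideal.quotientMap_injective
  have hmap : (degreeFiltration p.asIdeal t).map φ.toLinearMap =
      degreeFiltration q.asIdeal t := by
    ext x
    constructor
    · rintro ⟨y, hy, rfl⟩
      obtain ⟨f, hf, rfl⟩ := mem_degreeFiltration.mp hy
      exact mk_mem_degreeFiltration _ ((totalDegree_rename_le _ f).trans hf)
    · intro hx
      obtain ⟨f, hf, rfl⟩ := mem_degreeFiltration.mp hx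
      refine ⟨_, mk_mem_degreeFiltration _ ((totalDegree_rename_le Prod.snd f).trans hf), ?_⟩
      exact (Ideal.Quotient.eq.mpr (sub_mem_of_mem_diagonal hq r f)).symm
  rw [affineRank, affineRank, ← hmap]
  exact (Submodule.equivMapOfInjective φ.toLinearMap hφ _).finrank_eq

theorem projDegree_comap_projPullback {q : PrimeSpectrum (MvPolynomial (Fin s × Fin n) K)}
    (hq : q ∈ diagonal K n s) (r : Fin s) :
    projDegree (closureIdeal (PrimeSpectrum.comap (projPullback K n r).toRingHom q)) =
      projDegree (closureIdeal q) := by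
  have h : hilbertPolynomial (closureIdeal (PrimeSpectrum.comap (projPullback K n r).toRingHom q)) =
      hilbertPolynomial (closureIdeal q) := by
    refine eq_of_eventually_eval_eq ?_
    filter_upwards [eventually_eval_hilbertPolynomial_closureIdeal q,
      eventually_eval_hilbertPolynomial_closureIdeal
        (PrimeSpectrum.comap (projPullback K n r).toRingHom q)] with t h1 h2
    rw [h1, h2, affineRank_comap_projPullback hq]
  rw [projDegree, projDegree, h]

theorem degree_mapDomain_projPullback {Z : Cycle (MvPolynomial (Fin s × Fin n) K)}
    (hZ : ∀ q ∈ Z.support, q ∈ diagonal K n s) (r : Fin s) :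
    degree (Z.mapDomain (PrimeSpectrum.comap (projPullback K n r).toRingHom)) = degree Z := by
  rw [degree, Finsupp.sum_mapDomain_index (by simp) (by intros; push_cast; ring), degree]
  exact Finsupp.sum_congr fun q hq => by rw [projDegree_comap_projPullback (hZ q hq)]

theorem mem_diagonal_of_mem_support_cutList {ℓ : Fin (n * (s - 1)) → MvPolynomial (Fin s × Fin n) K}
    (hℓ : IsDiagonalSystem ℓ) {Z : Cycle (MvPolynomial (Fin s × Fin n) K)}
    {q : PrimeSpectrum (MvPolynomial (Fin s × Fin n) K)}
    (hq : q ∈ (cutList Z (List.ofFn ℓ)).support) : q ∈ diagonal K n s := by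
  rw [← hℓ.iInter_eq, Set.mem_iInter]
  intro k
  rw [PrimeSpectrum.mem_zeroLocus, Set.singleton_subset_iff]
  exact (mem_support_cutList _ hq).2 _ ((List.mem_ofFn' ℓ _).mpr ⟨k, rfl⟩)

end Diagonal

end VogelCycle
end

/-! ### The degree inequality for intersection cycles -/

theorem mainTheorem5 {K : Type*} [Field K] (n s : ℕ)
    (X : Fin s → VogelCycle.Cycle (MvPolynomial (Fin n) K)) (hX : ∀ j, 0 ≤ X j)
    (Z : VogelCycle.Cycle (MvPolynomial (Fin n) K))
    (hZ : VogelCycle.IsIntersectionCycle X Z) :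
    VogelCycle.degree Z ≤ ∏ j, VogelCycle.degree (X j) := by
  -- The index `r : Fin s` of the projection forces $s\ge 1$.
  obtain ⟨ℓ, r, hℓ, rfl⟩ := hZ
  rw [VogelCycle.degree_mapDomain_projPullback
    (fun q hq => VogelCycle.mem_diagonal_of_mem_support_cutList hℓ hq)]
  refine (VogelCycle.degree_cutList_le (fun f hf => ?_) (VogelCycle.prodCycle_nonneg hX)).trans
    (VogelCycle.degree_prodCycle_le hX)
  obtain ⟨k, rfl⟩ := (List.mem_ofFn' ℓ f).mp hf
  exact (hℓ.hyperplane k).le
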